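/- A \emph{3-tree} is a (finite, simple) graph that can be constructed from a complete graph on $4$ vertices by iteratively adding a new vertex and connecting it to all three vertices of a complete subgraph of order $3$ of the graph constructed so far (equivalently, an edge-maximal graph of tree-width $3$). For a graph $G$, let $\chi'(G)$ denote its chromatic index, i.e. the least number of colours in a colouring of the edges of $G$ in which adjacent edges receive different colours. $G$ is \emph{$k$-edge-choosable} if for each assignment of a list $L(e)\subseteq\mathbb{N}$ with $|L(e)|\ge k$ to every edge $e$ of $G$ there is a colouring $\mathcal{C}:E(G)\to\mathbb{N}$ with $\mathcal{C}(e)\in L(e)$ for each edge $e$ and with different colours on any two adjacent edges; the \emph{list chromatic index} $\mathrm{ch}'(G)$ is the smallest integer $k$ for which $G$ is $k$-edge-choosable. \textbf{Theorem.} Let $G$ be a 3-tree. Then $\mathrm{ch}'(G)=\chi'(G)$. -/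

import Mathlib

namespace SimpleGraph

/-- The chromatic index `χ'(G)`: the least number of colours with which the edges of `G` can be
coloured so that any two distinct edges sharing an endpoint receive different colours. It is the
chromatic number of the line graph, and takes values in `ℕ∞`. -/
noncomputable def chromaticIndex {V : Type*} (G : SimpleGraph V) : ℕ∞ :=
  G.lineGraph.chromaticNumber

/-- For an assignment `L` of lists of colours to the edges of `G`, the map `C` is an
`L`-edge-colouring: each edge gets a colour of its list, and adjacent edges (distinct edges sharing
an endpoint) get different colours. -/
def IsListEdgeColoring {V : Type*} (G : SimpleGraph V) (L : G.edgeSet → Set ℕ)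
    (C : G.edgeSet → ℕ) : Prop :=
  (∀ e, C e ∈ L e) ∧ ∀ e f, G.lineGraph.Adj e f → C e ≠ C f

/-- `G` is `k`-edge-choosable: for each assignment of lists, all of size at least `k`
(infinite lists are allowed), there is an `L`-edge-colouring of `G`. -/
def EdgeChoosable {V : Type*} (G : SimpleGraph V) (k : ℕ) : Prop :=
  ∀ L : G.edgeSet → Set ℕ, (∀ e, (k : ℕ∞) ≤ (L e).encard) →
    ∃ C : G.edgeSet → ℕ, G.IsListEdgeColoring L C

/-- The list chromatic index `ch'(G)`: the least `k` for which `G` is `k`-edge-choosable,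
with values in `ℕ∞`. -/
noncomputable def listChromaticIndex {V : Type*} (G : SimpleGraph V) : ℕ∞ :=
  ⨅ k ∈ {k : ℕ | G.EdgeChoosable k}, (k : ℕ∞)

/-- `G.IsKTreeOn k s`: the subgraph of `G` induced by the vertex set `s` can be constructed from a
complete graph on `k + 1` vertices by iteratively adding a new vertex `v` and connecting it to
all vertices of a complete subgraph `K` of order `k` (and to no other present vertex). -/
inductive IsKTreeOn {V : Type*} (G : SimpleGraph V) (k : ℕ) : Finset V → Prop
  | complete (s : Finset V) (hs : G.IsNClique (k + 1) s) : IsKTreeOn G k s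
  | add (s : Finset V) (v : V) (hv : v ∉ s) (K : Finset V) (hKs : K ⊆ s) (hK : G.IsNClique k K)
      (hadj : ∀ w ∈ s, G.Adj v w ↔ w ∈ K) (hs : IsKTreeOn G k s) :
      IsKTreeOn G k (Finset.cons v s hv)

/-- `G` is a `k`-tree. -/
def IsKTree {V : Type*} [Fintype V] (G : SimpleGraph V) (k : ℕ) : Prop :=
  G.IsKTreeOn k Finset.univ

end SimpleGraph

/-! A 3-tree is a triangle onto which a `Forest` of further vertices is stacked
(`IsKTreeOn.exists_forest`). Since χ' ≤ ch' always holds, it remains to show that such a graph is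
k-edge-choosable for k = χ'. This is `listColorable_of_listColorable_const`.

For k ≥ 6 only the bound k on the degrees is used. In a forest with at least three vertices there
are three or four that can be deleted so that a list colouring of the smaller stacked graph yields
one of the whole graph (`reducible_of_three_le_size`), and induction leaves forests with at most two
vertices. To restore the edges E at deleted vertices, consider an edge of E with ends u and w. A
surviving end u has at most k - deg_E(u) coloured edges, a deleted end has none, so of its k colours
at least capacity(u) + capacity(w) - k remain. `Flexible` asks for a colouring from arbitrary lists
of these sizes; it does not refer to the rest of the graph, so a finite list of configurations has
to be checked.

Nearly all of them are checked by the Alon–Tarsi method: by the Combinatorial Nullstellensatz, a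
colouring exists if the product of X i - X j over pairs of adjacent edges has a nonzero coefficient
at a monomial whose exponents are smaller than the list sizes. A number encoding such a monomial
serves as certificate, and the kernel computes the coefficient modulo 65536. The configurations with
three vertices in `flexible_narrow_three` are treated by Galvin's kernel argument instead.

For k < 6 there are at most three stacked vertices, because four force a vertex of degree 6
(`exists_six_le_edgeDegree`). With one or three of them the maximum degree gives k ≥ 3 or k ≥ 5;
with two, counting edges against matchings gives k ≥ 5 (`five_le_of_listColorable`). Certificates
show that lists of these sizes suffice. -/

/-! ### The Alon–Tarsi method for lists of inequations -/

namespace AlonTarsi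

open MvPolynomial

/-- The polynomial `∏ (X i - X j)` over the pairs `(i, j)` of a list. -/
noncomputable def diffPoly (F : List (ℕ × ℕ)) : MvPolynomial ℕ ℤ :=
  (F.map fun p => X p.1 - X p.2).prod

theorem diffPoly_cons (p : ℕ × ℕ) (F : List (ℕ × ℕ)) :
    diffPoly (p :: F) = X p.1 * diffPoly F - X p.2 * diffPoly F := by
  simp [diffPoly, sub_mul]

theorem diffPoly_isHomogeneous (F : List (ℕ × ℕ)) : (diffPoly F).IsHomogeneous F.length := by
  induction F with
  | nil => simpa [diffPoly] using isHomogeneous_one ℕ ℤ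
  | cons p F ih =>
    have h : diffPoly (p :: F) = (X p.1 - X p.2) * diffPoly F := by simp [diffPoly]
    rw [h, List.length_cons, add_comm]
    exact ((isHomogeneous_X ℤ p.1).sub (isHomogeneous_X ℤ p.2)).mul ih

theorem exists_coloring_of_coeff_ne_zero (F : List (ℕ × ℕ)) (t : ℕ →₀ ℕ)
    (ht : (diffPoly F).coeff t ≠ 0) (L : ℕ → Finset ℕ) (hL : ∀ i, t i < (L i).card) :
    ∃ c : ℕ → ℕ, (∀ i, c i ∈ L i) ∧ ∀ p ∈ F, c p.1 ≠ c p.2 := by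
  classical
  set s : Set ℕ := {i | ∃ p ∈ F, i = p.1 ∨ i = p.2} with hs
  have hfin : s.Finite := by
    refine ((F.map Prod.fst ++ F.map Prod.snd).toFinset.finite_toSet).subset ?_
    rintro i ⟨p, hp, rfl | rfl⟩
    · simp only [List.toFinset_append, Finset.coe_union, Set.mem_union, Finset.mem_coe,
        List.mem_toFinset, List.mem_map]
      exact Or.inl ⟨p, hp, rfl⟩
    · simp only [List.toFinset_append, Finset.coe_union, Set.mem_union, Finset.mem_coe,
        List.mem_toFinset, List.mem_map]
      exact Or.inr ⟨p, hp, rfl⟩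
  have hmem : diffPoly F ∈ supported ℤ s := by
    refine Subalgebra.list_prod_mem _ ?_
    intro q hq
    obtain ⟨p, hp, rfl⟩ := List.mem_map.1 hq
    exact Subalgebra.sub_mem _ (X_mem_supported.2 ⟨p, hp, Or.inl rfl⟩)
      (X_mem_supported.2 ⟨p, hp, Or.inr rfl⟩)
  -- The Nullstellensatz needs finitely many variables, so the polynomial is rewritten in those that
  -- occur in `F`.
  rw [supported_eq_range_rename] at hmem
  obtain ⟨f, hf⟩ := hmem
  change rename Subtype.val f = diffPoly F at hf
  rw [← hf] at ht
  obtain ⟨u, hu, hu0⟩ := coeff_rename_ne_zero _ _ _ ht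
  have hhom : f.IsHomogeneous F.length := by
    rw [← IsHomogeneous.rename_isHomogeneous_iff Subtype.val_injective, hf]
    exact diffPoly_isHomogeneous F
  have hdeg : f.totalDegree = u.degree := by
    rw [hhom.totalDegree (fun h => hu0 (by simp [h]))]
    have := hhom hu0
    rw [← this, Finsupp.degree_eq_weight_one]
    rfl
  have : Finite s := hfin
  obtain ⟨x, hx, hx0⟩ := combinatorial_nullstellensatz_exists_eval_nonzero f u hu0 hdeg
    (fun i => (L i).map Nat.castEmbedding) (fun i => by
      rw [Finset.card_map]
      have := hL i
      rwa [← hu, Finsupp.mapDomain_apply Subtype.val_injective] at this)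
  have hne : ∀ i, (L i).Nonempty := fun i => Finset.card_pos.1 (Nat.zero_lt_of_lt (hL i))
  have hx' : ∀ i : s, ∃ n ∈ L i, (n : ℤ) = x i := fun i => by simpa using hx i
  choose y hyL hyx using hx'
  refine ⟨fun i => if h : i ∈ s then y ⟨i, h⟩ else (hne i).choose, fun i => ?_, fun p hp h => ?_⟩
  · by_cases h : i ∈ s
    · simpa [h] using hyL ⟨i, h⟩
    · simpa [h] using (hne i).choose_spec
  · have h1 : p.1 ∈ s := ⟨p, hp, Or.inl rfl⟩
    have h2 : p.2 ∈ s := ⟨p, hp, Or.inr rfl⟩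
    simp only [h1, h2, dif_pos] at h
    apply hx0
    have hev : eval x f = eval (fun i => if h : i ∈ s then x ⟨i, h⟩ else 0) (diffPoly F) := by
      rw [← hf, eval_rename]
      congr 1
      congr 1
      funext i
      simp
    rw [hev, diffPoly, map_list_prod, List.prod_eq_zero_iff, List.map_map]
    refine List.mem_map.2 ⟨p, hp, ?_⟩
    simp [h1, h2, ← hyx, h]

/-! ### Computing coefficients -/

/-- The exponent of the `i`-th variable in the monomial with code `n` (base 16 digits). -/
def digit (n i : ℕ) : ℕ := n / 16 ^ i % 16

theorem le_of_digit_ne_zero {n i : ℕ} (h : digit n i ≠ 0) : i ≤ n := by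
  by_contra hlt
  have h1 : n < 16 ^ i := lt_of_lt_of_le (by omega) (Nat.lt_pow_self (by norm_num : 1 < 16)).le
  exact h (by simp [digit, Nat.div_eq_of_lt h1])

/-- The monomial with code `n`. -/
noncomputable def decode (n : ℕ) : ℕ →₀ ℕ :=
  Finsupp.onFinset (Finset.range (n + 1)) (digit n) fun _ h =>
    Finset.mem_range.2 (Nat.lt_succ_of_le (le_of_digit_ne_zero h))

@[simp] theorem decode_apply (n i : ℕ) : decode n i = digit n i := rfl

@[simp] theorem decode_zero : decode 0 = 0 := by
  ext i; simp [digit]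

theorem digit_sub_self {n i : ℕ} (h : digit n i ≠ 0) : digit (n - 16 ^ i) i = digit n i - 1 := by
  have h1 : (n - 16 ^ i) / 16 ^ i = n / 16 ^ i - 1 := by
    simpa using Nat.sub_mul_div n (16 ^ i) 1
  unfold digit at *
  rw [h1]
  generalize n / 16 ^ i = q at *
  omega

/-- There is no borrow: the digits below `i` see a multiple of a higher power of 16 subtracted, and
the nonzero digit at `i` absorbs the subtraction before it reaches the digits above. -/
theorem digit_sub_of_ne {n i j : ℕ} (h : digit n i ≠ 0) (hij : j ≠ i) :
    digit (n - 16 ^ i) j = digit n j := by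
  unfold digit at *
  rcases lt_or_gt_of_ne hij with hlt | hlt
  · obtain ⟨r, rfl⟩ := Nat.exists_eq_add_of_lt hlt
    have h1 : (n - 16 ^ (j + r + 1)) / 16 ^ j = n / 16 ^ j - 16 ^ (r + 1) := by
      rw [add_assoc, pow_add]
      exact Nat.sub_mul_div n (16 ^ j) (16 ^ (r + 1))
    have h2 : 16 ^ (r + 1) ≤ n / 16 ^ j := by
      rw [Nat.le_div_iff_mul_le (by positivity), ← pow_add]
      by_contra hcon
      rw [Nat.div_eq_of_lt (by rw [show j + r + 1 = r + 1 + j by ring]; omega)] at h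
      simp at h
    rw [h1]
    rw [pow_succ] at *
    omega
  · obtain ⟨r, rfl⟩ := Nat.exists_eq_add_of_lt hlt
    have h1 : (n - 16 ^ i) / 16 ^ i = n / 16 ^ i - 1 := by
      simpa using Nat.sub_mul_div n (16 ^ i) 1
    have key : ∀ m : ℕ, m / 16 ^ (i + r + 1) = m / 16 ^ i / 16 / 16 ^ r := by
      intro m
      rw [Nat.div_div_eq_div_mul, Nat.div_div_eq_div_mul]
      congr 1
      ring
    rw [key, key, h1]
    generalize n / 16 ^ i = q at *
    rw [show (q - 1) / 16 = q / 16 by omega]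

theorem decode_sub_single {n i : ℕ} (h : digit n i ≠ 0) :
    decode n - Finsupp.single i 1 = decode (n - 16 ^ i) := by
  ext j
  by_cases hij : j = i
  · subst hij
    simp [digit_sub_self h]
  · simp [digit_sub_of_ne h hij, Ne.symm hij]

/-- The coefficient of `diffPoly F` at the monomial with code `n`. -/
noncomputable def coeffAt (F : List (ℕ × ℕ)) (n : ℕ) : ℤ := (diffPoly F).coeff (decode n)

theorem coeff_X_mul_decode (i n : ℕ) (f : MvPolynomial ℕ ℤ) :
    (X i * f).coeff (decode n) =
      if digit n i = 0 then 0 else f.coeff (decode (n - 16 ^ i)) := by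
  rw [coeff_X_mul']
  by_cases h : digit n i = 0
  · simp [h]
  · simp [h, decode_sub_single h]

/-- This is the recursion behind the certificates. The computation starts at the target monomial and
divides by variables, factor by factor, so the product itself is never expanded. -/
theorem coeffAt_cons (p : ℕ × ℕ) (F : List (ℕ × ℕ)) (n : ℕ) :
    coeffAt (p :: F) n =
      (if digit n p.1 = 0 then 0 else coeffAt F (n - 16 ^ p.1)) -
      (if digit n p.2 = 0 then 0 else coeffAt F (n - 16 ^ p.2)) := by
  simp only [coeffAt, diffPoly_cons, coeff_sub, coeff_X_mul_decode]

/-- Only `js.length` factors contain the `i`-th variable, which bounds its exponent. This justifies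
discarding monomials in `restrict`. -/
theorem coeffAt_eq_zero (js : List ℕ) (F : List (ℕ × ℕ)) (i n : ℕ)
    (hF : ∀ p ∈ F, p.1 ≠ i ∧ p.2 ≠ i) (hjs : ∀ j ∈ js, j ≠ i) (hn : js.length < digit n i) :
    coeffAt (js.map (fun j => (i, j)) ++ F) n = 0 := by
  induction js generalizing n with
  | nil =>
    rw [List.map_nil, List.nil_append]
    rw [List.length_nil] at hn
    clear hjs
    induction F generalizing n with
    | nil =>
      have : decode n ≠ 0 := fun h => hn.ne' (by simpa using DFunLike.congr_fun h i)
      simp [coeffAt, diffPoly, coeff_one, Ne.symm this]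
    | cons p F ih =>
      have hp := hF p (by simp)
      have key : ∀ j, j ≠ i → (if digit n j = 0 then 0 else coeffAt F (n - 16 ^ j)) = 0 := by
        intro j hj
        split_ifs with h
        · rfl
        · exact ih (fun q hq => hF q (by simp [hq])) _ (by rwa [digit_sub_of_ne h hj.symm])
      rw [coeffAt_cons, key _ hp.1, key _ hp.2, sub_zero]
  | cons j js ih =>
    have hjs' : ∀ j ∈ js, j ≠ i := fun j hj => hjs j (by simp [hj])
    rw [List.length_cons] at hn
    rw [List.map_cons, List.cons_append, coeffAt_cons]
    have h1 : digit n i ≠ 0 := by omega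
    rw [if_neg h1, ih _ hjs' (by rw [digit_sub_self h1]; omega)]
    split_ifs with h
    · rfl
    · rw [ih _ hjs' (by rw [digit_sub_of_ne h (hjs j (by simp)).symm]; omega), sub_zero]

/-- A weighted list of codes of monomials, in increasing order of the codes. The weights are
integers modulo `65536`. -/
abbrev Weights := List (ℕ × ℕ)

/-- The weighted sum of `g` over a list of weights. -/
def Weights.total (g : ℕ → ℤ) (P : Weights) : ℤ := (P.map fun x => (x.2 : ℤ) * g x.1).sum

@[simp] theorem Weights.total_nil (g : ℕ → ℤ) : Weights.total g [] = 0 := rfl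

@[simp] theorem Weights.total_cons (g : ℕ → ℤ) (x : ℕ × ℕ) (P : Weights) :
    Weights.total g (x :: P) = x.2 * g x.1 + Weights.total g P := by
  simp [Weights.total]

/-! The following functions are written with recursors, which the kernel evaluates much faster
than compiled structural recursion. -/

/-- Divide each monomial by the variable with place value `q`, dropping those in which it does not
occur, and multiply the weights by `s`. -/
noncomputable def shift (q s : ℕ) (P : Weights) : Weights :=
  List.rec [] (fun x _ ih =>
    Bool.rec ((Nat.sub x.1 q, Nat.mod (Nat.mul s x.2) 65536) :: ih) ih
      (Nat.beq (Nat.mod (Nat.div x.1 q) 16) 0)) P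

/-- Merge two increasing lists of weights, adding the weights of equal monomials. -/
noncomputable def merge (A : Weights) : Weights → Weights :=
  List.rec (fun B => B) (fun x A mergeA B => List.rec (x :: A) (fun y B ih =>
    Bool.rec
      (Bool.rec
        (Bool.rec ((x.1, Nat.mod (Nat.add x.2 y.2) 65536) :: mergeA B) (mergeA B)
          (Nat.beq (Nat.mod (Nat.add x.2 y.2) 65536) 0))
        (y :: ih) (Nat.blt y.1 x.1))
      (x :: mergeA (y :: B)) (Nat.blt x.1 y.1)) B) A

/-- The monomials in which the variable with place value `q` has exponent at most `r`. -/
noncomputable def restrict (q r : ℕ) (P : Weights) : Weights :=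
  List.rec [] (fun x _ ih => Bool.rec ih (x :: ih) (Nat.ble (Nat.mod (Nat.div x.1 q) 16) r)) P

/-- Treat the factors `X i - X j` for `j` in a list, discarding the monomials in which the
exponent of the `i`-th variable exceeds the number of factors left. -/
noncomputable def eliminate (i : ℕ) : List ℕ → Weights → Weights
  | [], P => restrict (16 ^ i) 0 P
  | j :: js, P => eliminate i js
      (restrict (16 ^ i) js.length (merge (shift (16 ^ i) 1 P) (shift (16 ^ j) 65535 P)))

theorem shift_cons (i s : ℕ) (x : ℕ × ℕ) (P : Weights) :
    shift (16 ^ i) s (x :: P) = if digit x.1 i = 0 then shift (16 ^ i) s P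
      else (x.1 - 16 ^ i, s * x.2 % 65536) :: shift (16 ^ i) s P := by
  change @Bool.rec (fun _ => Weights) _ _ (Nat.beq (digit x.1 i) 0) = _
  cases h : Nat.beq (digit x.1 i) 0
  · rw [if_neg (Nat.ne_of_beq_eq_false h)]
    rfl
  · rw [if_pos (Nat.eq_of_beq_eq_true h)]
    rfl

theorem restrict_cons (i r : ℕ) (x : ℕ × ℕ) (P : Weights) :
    restrict (16 ^ i) r (x :: P) = if digit x.1 i ≤ r then x :: restrict (16 ^ i) r P
      else restrict (16 ^ i) r P := by
  change @Bool.rec (fun _ => Weights) _ _ (Nat.ble (digit x.1 i) r) = _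
  cases h : Nat.ble (digit x.1 i) r
  · rw [if_neg (Nat.not_le_of_not_ble_eq_true (by simp [h]))]
    rfl
  · rw [if_pos (Nat.le_of_ble_eq_true h)]
    rfl

theorem merge_cons_cons (x y : ℕ × ℕ) (A B : Weights) :
    merge (x :: A) (y :: B) =
      if x.1 < y.1 then x :: merge A (y :: B) else if y.1 < x.1 then y :: merge (x :: A) B
      else if (x.2 + y.2) % 65536 = 0 then merge A B
      else (x.1, (x.2 + y.2) % 65536) :: merge A B := by
  change @Bool.rec (fun _ => Weights) (@Bool.rec (fun _ => Weights) (@Bool.rec (fun _ => Weights)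
    ((x.1, (x.2 + y.2) % 65536) :: merge A B) (merge A B) (Nat.beq ((x.2 + y.2) % 65536) 0))
    (y :: merge (x :: A) B) (Nat.blt y.1 x.1)) (x :: merge A (y :: B)) (Nat.blt x.1 y.1) = _
  have hrec : ∀ (b : Bool) (P Q : Weights),
      @Bool.rec (fun _ => Weights) P Q b = if b then Q else P := by
    rintro (_ | _) P Q <;> rfl
  simp only [hrec, Nat.blt_eq, Nat.beq_eq]

theorem total_shift (g : ℕ → ℤ) (i s : ℕ) (P : Weights) :
    (shift (16 ^ i) s P).total g ≡
      s * P.total (fun n => if digit n i = 0 then 0 else g (n - 16 ^ i)) [ZMOD 65536] := by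
  induction P with
  | nil => simp [shift]
  | cons x P ih =>
    rw [shift_cons]
    by_cases h : digit x.1 i = 0
    · simpa [h] using ih
    · simp only [h, if_false, Weights.total_cons, mul_add, ← mul_assoc]
      refine Int.ModEq.add (Int.ModEq.mul_right _ ?_) ih
      push_cast
      exact Int.mod_modEq _ _

/-- No sortedness is assumed: the order of the codes serves to bring equal monomials together, and
soundness does not depend on it. -/
theorem total_merge (g : ℕ → ℤ) (A B : Weights) :
    (merge A B).total g ≡ A.total g + B.total g [ZMOD 65536] := by
  induction A generalizing B with
  | nil => simp [merge]
  | cons x A ihA =>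
    induction B with
    | nil => simp [merge]
    | cons y B ihB =>
      have key : x.1 = y.1 → (((x.2 + y.2) % 65536 : ℕ) : ℤ) * g x.1 +
          (Weights.total g A + Weights.total g B) ≡
          x.2 * g x.1 + Weights.total g A + (y.2 * g y.1 + Weights.total g B) [ZMOD 65536] := fun h => by
        have h1 : (((x.2 + y.2) % 65536 : ℕ) : ℤ) ≡ x.2 + y.2 [ZMOD 65536] := by
          push_cast
          exact Int.mod_modEq _ _
        have h2 := (h1.mul_right (g x.1)).add_right (Weights.total g A + Weights.total g B)
        rw [← h]
        convert h2 using 1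
        ring
      rw [merge_cons_cons]
      split_ifs with h1 h2 h3
      · have := (ihA (y :: B)).add_left (x.2 * g x.1)
        simp only [Weights.total_cons] at this ⊢
        convert this using 1
        ring
      · have := ihB.add_left (y.2 * g y.1)
        simp only [Weights.total_cons] at this ⊢
        convert this using 1
        ring
      · have := key (by omega)
        rw [h3] at this
        simp only [Weights.total_cons]
        exact (ihA B).trans (by simpa using this)
      · simp only [Weights.total_cons]
        exact ((ihA B).add_left _).trans (key (by omega))

theorem total_restrict (g : ℕ → ℤ) (i r : ℕ) (hg : ∀ n, r < digit n i → g n = 0)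
    (P : Weights) : (restrict (16 ^ i) r P).total g = P.total g := by
  induction P with
  | nil => simp [restrict]
  | cons x P ih =>
    rw [restrict_cons]
    by_cases h : digit x.1 i ≤ r
    · simp [h, ih]
    · simp [h, ih, hg _ (not_le.1 h)]

theorem total_eliminate (i : ℕ) (F : List (ℕ × ℕ)) (hF : ∀ p ∈ F, p.1 ≠ i ∧ p.2 ≠ i)
    (js : List ℕ) (hjs : ∀ j ∈ js, j ≠ i) (P : Weights) :
    (eliminate i js P).total (coeffAt F) ≡
      P.total (coeffAt (js.map (fun j => (i, j)) ++ F)) [ZMOD 65536] := by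
  induction js generalizing P with
  | nil =>
    rw [eliminate, total_restrict (coeffAt F) _ _ fun n hn => coeffAt_eq_zero [] F i n hF
      (by simp) (by simpa using hn)]
    rfl
  | cons j js ih =>
    have hjs' : ∀ j ∈ js, j ≠ i := fun j hj => hjs j (by simp [hj])
    refine (ih hjs' _).trans ?_
    rw [total_restrict _ _ _ fun n hn => coeffAt_eq_zero js F i n hF hjs' hn]
    refine (total_merge _ _ _).trans (((total_shift _ _ _ _).add (total_shift _ _ _ _)).trans ?_)
    -- Weights are natural numbers, so the minus sign of `X j` is represented by 65535.
    have h1 : ((65535 : ℕ) : ℤ) ≡ -1 [ZMOD 65536] := by decide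
    refine ((h1.mul_right _).add_left _).trans ?_
    rw [Int.ModEq]
    congr 1
    simp only [Weights.total, List.map_cons, List.cons_append, coeffAt_cons]
    induction P with
    | nil => simp
    | cons x P ihP =>
      simp only [List.map_cons, List.sum_cons] at ihP ⊢
      linear_combination ihP

end AlonTarsi

/-! ### List colourings of the edges of a numerical graph -/

namespace EdgeList

open AlonTarsi

/-- Two pairs of numbers have an entry in common. -/
def touch (e f : ℕ × ℕ) : Bool := e.1 == f.1 || e.1 == f.2 || e.2 == f.1 || e.2 == f.2

/-- The number of edges at the vertex `u`. -/
def degree (E : List (ℕ × ℕ)) (u : ℕ) : ℕ := E.countP fun e => e.1 == u || e.2 == u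

/-- The number of colours available at `u`: the degree at a boundary vertex, `k` elsewhere. -/
def capacity (E : List (ℕ × ℕ)) (B k u : ℕ) : ℕ := if u < B then degree E u else k

/-- The list has no repeated edges. -/
def Simple (E : List (ℕ × ℕ)) : Prop := E.Pairwise fun e f => s(e.1, e.2) ≠ s(f.1, f.2)

instance (E : List (ℕ × ℕ)) : Decidable (Simple E) := inferInstanceAs (Decidable (E.Pairwise _))

/-- Let the vertices `u < B` be joined to a coloured graph and have degree at most `k` in the
union. Then the edges of `E` can be coloured from those colours of lists of size `k` which do not
yet occur at an adjacent edge. -/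
def Flexible (E : List (ℕ × ℕ)) (B k : ℕ) : Prop :=
  Simple E ∧ ∀ L : ℕ → Finset ℕ,
    (∀ i (h : i < E.length), capacity E B k E[i].1 + capacity E B k E[i].2 ≤ (L i).card + k) →
    ∃ c : ℕ → ℕ, (∀ i < E.length, c i ∈ L i) ∧
      ∀ i j (hj : j < E.length) (hij : i < j), touch E[i] E[j] → c i ≠ c j

/-- The first end of each edge is interior and has capacity `k`, which cancels against the `k` on
the other side. What remains is the capacity of the second end as lower bound for the list, and this
does not decrease with `k`. The argument breaks down for an edge with both ends on the boundary. -/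
theorem Flexible.mono {E : List (ℕ × ℕ)} {B k l : ℕ} (h : Flexible E B k) (hkl : k ≤ l)
    (hE : ∀ e ∈ E, B ≤ e.1) : Flexible E B l := by
  refine ⟨h.1, fun L hL => h.2 L fun i hi => ?_⟩
  have h1 := hL i hi
  have h2 := hE _ (List.getElem_mem hi)
  simp only [capacity, Nat.not_lt.2 h2, if_false] at h1 ⊢
  split_ifs at h1 ⊢ <;> omega

/-! #### Certificates by the Alon–Tarsi method -/

/-- The indices, starting with `i`, of the pairs of a list which touch `e`. -/
def touching (e : ℕ × ℕ) : ℕ → List (ℕ × ℕ) → List ℕ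
  | _, [] => []
  | i, f :: E => if touch e f then i :: touching e (i + 1) E else touching e (i + 1) E

/-- The pairs of indices, starting with `i`, of touching pairs of a list. -/
def conflicts : ℕ → List (ℕ × ℕ) → List (ℕ × ℕ)
  | _, [] => []
  | i, e :: E => (touching e (i + 1) E).map (fun j => (i, j)) ++ conflicts (i + 1) E

/-- Expand the product of the differences over `conflicts i E`. -/
noncomputable def expand : ℕ → List (ℕ × ℕ) → Weights → Weights
  | _, [], P => P
  | i, e :: E, P => expand (i + 1) E (eliminate i (touching e (i + 1) E) P)

theorem le_of_mem_touching {e : ℕ × ℕ} {i j : ℕ} {E : List (ℕ × ℕ)} (h : j ∈ touching e i E) :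
    i ≤ j := by
  induction E generalizing i with
  | nil => simp [touching] at h
  | cons f E ih =>
    unfold touching at h
    split_ifs at h
    · rcases List.mem_cons.1 h with rfl | h
      · exact le_rfl
      · exact (Nat.le_succ i).trans (ih h)
    · exact (Nat.le_succ i).trans (ih h)

theorem le_of_mem_conflicts {i : ℕ} {p : ℕ × ℕ} {E : List (ℕ × ℕ)} (h : p ∈ conflicts i E) :
    i ≤ p.1 ∧ i ≤ p.2 := by
  induction E generalizing i with
  | nil => simp [conflicts] at h
  | cons f E ih =>
    rcases List.mem_append.1 h with h | h
    · obtain ⟨j, hj, rfl⟩ := List.mem_map.1 h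
      have := le_of_mem_touching hj
      exact ⟨le_rfl, by dsimp only; omega⟩
    · have := ih h
      omega

/-- Later conflicts involve only indices above `i`, so the variables can be eliminated one after
another until the empty product 1 is left. -/
theorem total_expand (i : ℕ) (E : List (ℕ × ℕ)) (P : Weights) :
    (expand i E P).total (coeffAt []) ≡ P.total (coeffAt (conflicts i E)) [ZMOD 65536] := by
  induction E generalizing i P with
  | nil => rfl
  | cons e E ih =>
    refine (ih _ _).trans (total_eliminate i _ (fun p hp => ?_) _ (fun j hj => ?_) P)
    · have := le_of_mem_conflicts hp
      omega
    · have := le_of_mem_touching hj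
      omega

theorem mem_touching {e : ℕ × ℕ} {E : List (ℕ × ℕ)} {j : ℕ} (hj : j < E.length)
    (h : touch e E[j]) (i : ℕ) : i + j ∈ touching e i E := by
  induction E generalizing i j with
  | nil => simp at hj
  | cons f E ih =>
    unfold touching
    cases j with
    | zero => simp_all
    | succ j =>
      have := ih (j := j) (by simpa using hj) (by simpa using h) (i + 1)
      rw [show i + (j + 1) = i + 1 + j by ring]
      split_ifs
      · exact List.mem_cons_of_mem _ this
      · exact this

theorem mem_conflicts {E : List (ℕ × ℕ)} {i j : ℕ} (hj : j < E.length) (hij : i < j)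
    (h : touch E[i] E[j]) (s : ℕ) : (s + i, s + j) ∈ conflicts s E := by
  induction E generalizing i j s with
  | nil => simp at hj
  | cons f E ih =>
    obtain ⟨j, rfl⟩ : ∃ r, j = r + 1 := ⟨j - 1, by omega⟩
    unfold conflicts
    cases i with
    | zero =>
      refine List.mem_append_left _ (List.mem_map.2 ⟨s + (j + 1), ?_, by simp⟩)
      rw [show s + (j + 1) = s + 1 + j by ring]
      exact mem_touching (by simpa using hj) (by simpa using h) _
    | succ i =>
      refine List.mem_append_right _ ?_
      have := ih (i := i) (j := j) (by simpa using hj) (by omega) (by simpa using h) (s + 1)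
      rwa [show s + (i + 1) = s + 1 + i by ring, show s + (j + 1) = s + 1 + j by ring]

/-- The monomial with code `n` certifies that `E` is flexible. -/
noncomputable def certifies (E : List (ℕ × ℕ)) (B k n : ℕ) : Bool :=
  decide (Simple E) &&
    (E.zipIdx.all fun x => digit n x.2 + k < capacity E B k x.1.1 + capacity E B k x.1.2) &&
    match expand 0 E [(n, 1)] with
    | [(0, w)] => w % 65536 != 0
    | _ => false

/-- The expansion ends with a multiple `w` of the constant monomial, and `w` is congruent to the
wanted coefficient modulo 65536; a nonzero residue therefore suffices. -/
theorem flexible_of_certifies {E : List (ℕ × ℕ)} {B k n : ℕ} (h : certifies E B k n) :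
    Flexible E B k := by
  obtain ⟨h1, h2⟩ := Bool.and_eq_true_iff.1 h
  obtain ⟨h0, h1⟩ := Bool.and_eq_true_iff.1 h1
  refine ⟨of_decide_eq_true h0, ?_⟩
  have hcoeff : (diffPoly (conflicts 0 E)).coeff (decode n) ≠ 0 := by
    have h3 := total_expand 0 E [(n, 1)]
    split at h2
    next w hw =>
      rw [hw] at h3
      simp only [Weights.total_cons, Weights.total_nil, coeffAt, diffPoly, decode_zero,
        List.map_nil, List.prod_nil, MvPolynomial.coeff_zero_one, one_mul, add_zero,
        mul_one, Nat.cast_one] at h3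
      simp only [diffPoly]
      intro h0
      rw [h0, Int.modEq_zero_iff_dvd] at h3
      have h4 : w % 65536 = 0 := by omega
      simp [h4] at h2
    next => exact absurd h2 (by simp)
  intro L hL
  obtain ⟨c, hc, hF⟩ := exists_coloring_of_coeff_ne_zero _ _ hcoeff
    -- Indices beyond the list carry no edge; they receive dummy lists just long enough for the
    -- hypothesis on all natural numbers.
    (fun i => if i < E.length then L i else Finset.range (digit n i + 1)) (fun i => by
      rw [decode_apply]
      split_ifs with hi
      · have h3 := List.all_eq_true.1 h1 (E[i], i) (by
          rw [List.mem_zipIdx_iff_getElem?]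
          simp [hi])
        have h4 := hL i hi
        simp only [decide_eq_true_eq] at h3
        omega
      · simp)
  refine ⟨c, fun i hi => by simpa [hi] using hc i, fun i j hj hij ht => ?_⟩
  simpa using hF _ (mem_conflicts hj hij ht 0)

end EdgeList

/-! ### Forests of stacked vertices -/

universe u

/-- The ways to stack vertices onto an ordered triangle `(a, b, c)`: in `cons v A B C R` the vertex
`v` is joined to `a`, `b`, `c`, the forests `A`, `B`, `C` are stacked onto the triangles
`(v, b, c)`, `(a, v, c)`, `(a, b, v)`, and `R` onto `(a, b, c)`. -/
inductive Forest (V : Type u)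
  | nil : Forest V
  | cons (v : V) (A B C R : Forest V) : Forest V

namespace Forest

variable {V : Type u}

/-- The vertices of a forest. -/
def verts : Forest V → List V
  | nil => []
  | cons v A B C R => v :: (A.verts ++ (B.verts ++ (C.verts ++ R.verts)))

/-- The edges at the vertices of a forest stacked onto a triangle. -/
def edges : Forest V → V → V → V → List (V × V)
  | nil, _, _, _ => []
  | cons v A B C R, a, b, c =>
    A.edges v b c ++ (B.edges a v c ++ (C.edges a b v ++
      ((v, a) :: (v, b) :: (v, c) :: R.edges a b c)))

/-- The number of vertices of a forest. -/
def size : Forest V → ℕ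
  | nil => 0
  | cons _ A B C R => A.size + B.size + C.size + R.size + 1

/-- All forests with vertices `s, s + 1, …, s + n - 1` in this order. -/
def enum : ℕ → ℕ → List (Forest ℕ) := fun n => go n n where
  /-- Enumeration with bounded recursion depth. -/
  go : ℕ → ℕ → ℕ → List (Forest ℕ)
  | _, 0, _ => [nil]
  | 0, _ + 1, _ => []
  | d + 1, n + 1, s =>
    (List.range (n + 1)).flatMap fun i => (List.range (n + 1 - i)).flatMap fun j =>
      (List.range (n + 1 - i - j)).flatMap fun k =>
        (go d i (s + 1)).flatMap fun A => (go d j (s + 1 + i)).flatMap fun B =>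
          (go d k (s + 1 + i + j)).flatMap fun C =>
            (go d (n - i - j - k) (s + 1 + i + j + k)).map fun R => cons s A B C R

end Forest

/-! ### Galvin's method -/

/-- If each set of vertices of a digraph has a kernel, then its vertices can be coloured from lists
that are longer than the out-degrees. -/
theorem exists_coloring_of_kernels {ι : Type*} [DecidableEq ι] (D : ι → ι → Prop)
    [DecidableRel D] (S : Finset ι)
    (hker : ∀ T ⊆ S, ∃ M ⊆ T, (∀ x ∈ M, ∀ y ∈ M, ¬ D x y) ∧ ∀ x ∈ T, x ∉ M → ∃ y ∈ M, D x y)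
    (L : ι → Finset ℕ) (hL : ∀ x ∈ S, (S.filter (D x)).card < (L x).card) :
    ∃ c : ι → ℕ, (∀ x ∈ S, c x ∈ L x) ∧ ∀ x ∈ S, ∀ y ∈ S, D x y → c x ≠ c y := by
  induction S using Finset.strongInduction generalizing L with
  | H S ih =>
    rcases S.eq_empty_or_nonempty with rfl | ⟨x₀, hx₀⟩
    · exact ⟨fun _ => 0, by simp, by simp⟩
    -- Some colour `a` is given to a kernel `M` of the vertices whose lists contain it. Each other
    -- vertex with `a` in its list loses this colour, but also an out-neighbour in `M`, so the
    -- inequality survives on `S \ M`.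
    obtain ⟨a, ha⟩ := Finset.card_pos.1 (Nat.zero_lt_of_lt (hL x₀ hx₀))
    obtain ⟨M, hMT, hind, hdom⟩ := hker (S.filter fun x => a ∈ L x) (Finset.filter_subset _ _)
    have hMS : M ⊆ S := hMT.trans (Finset.filter_subset _ _)
    have hMne : M.Nonempty := by
      by_cases h : x₀ ∈ M
      · exact ⟨x₀, h⟩
      · obtain ⟨y, hy, -⟩ := hdom x₀ (by simp [hx₀, ha]) h
        exact ⟨y, hy⟩
    obtain ⟨c, hc, hD⟩ := ih (S \ M) (Finset.sdiff_ssubset hMS hMne)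
      (fun T hT => hker T (hT.trans Finset.sdiff_subset)) (fun x => (L x).erase a) (by
        intro x hx
        obtain ⟨hxS, hxM⟩ := Finset.mem_sdiff.1 hx
        have hsub : (S \ M).filter (D x) ⊆ S.filter (D x) :=
          Finset.filter_subset_filter _ Finset.sdiff_subset
        by_cases hax : a ∈ L x
        · obtain ⟨y, hy, hxy⟩ := hdom x (by simp [hxS, hax]) hxM
          have hlt : ((S \ M).filter (D x)).card < (S.filter (D x)).card := by
            refine Finset.card_lt_card (Finset.ssubset_iff_subset_ne.2 ⟨hsub, fun h => ?_⟩)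
            have : y ∈ (S \ M).filter (D x) := by rw [h]; simp [hMS hy, hxy]
            simp [hy] at this
          have := hL x hxS
          rw [Finset.card_erase_of_mem hax]
          omega
        · rw [Finset.erase_eq_of_notMem hax]
          exact (Finset.card_le_card hsub).trans_lt (hL x hxS))
    refine ⟨fun x => if x ∈ M then a else c x, fun x hx => ?_, fun x hx y hy hxy => ?_⟩
    · by_cases h : x ∈ M
      · simpa [h] using (Finset.mem_filter.1 (hMT h)).2
      · simpa [h] using Finset.mem_of_mem_erase (hc x (by simp [hx, h]))
    · by_cases h1 : x ∈ M <;> by_cases h2 : y ∈ M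
      · exact absurd hxy (hind x h1 y h2)
      · simpa [h1, h2] using (Finset.ne_of_mem_erase (hc y (by simp [hy, h2]))).symm
      · simpa [h1, h2] using Finset.ne_of_mem_erase (hc x (by simp [hx, h1]))
      · simpa [h1, h2] using hD x (by simp [hx, h1]) y (by simp [hy, h2]) hxy

/-- In the preference orders of a properly edge-coloured bipartite multigraph, where one side
prefers small and the other side large colours, each set of edges has a kernel. -/
theorem exists_kernel_of_bipartite {ι : Type*} [DecidableEq ι] (u w r : ι → ℕ) (S : Finset ι)
    (hr : ∀ x ∈ S, ∀ y ∈ S, x ≠ y → (u x = u y ∨ w x = w y) → r x ≠ r y) :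
    ∃ M ⊆ S, (∀ x ∈ M, ∀ y ∈ M, ¬ ((u x = u y ∧ r y < r x) ∨ (w x = w y ∧ r x < r y))) ∧
      ∀ x ∈ S, x ∉ M → ∃ y ∈ M, (u x = u y ∧ r y < r x) ∨ (w x = w y ∧ r x < r y) := by
  induction S using Finset.strongInduction with
  | H S ih =>
    -- Stable matching: `P` consists of the edges preferred most at their `u`-ends. If no two of
    -- them meet at a `w`-end, then `P` is a kernel.
    set P := S.filter fun x => ∀ y ∈ S, u y = u x → r x ≤ r y with hP
    by_cases hinj : ∀ x ∈ P, ∀ y ∈ P, w x = w y → x = y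
    · refine ⟨P, Finset.filter_subset _ _, ?_, ?_⟩
      · rintro x hx y hy (⟨h1, h2⟩ | ⟨h1, h2⟩)
        · exact absurd ((Finset.mem_filter.1 hx).2 y (Finset.mem_filter.1 hy).1 h1.symm) (by omega)
        · exact absurd (hinj x hx y hy h1 ▸ h2) (lt_irrefl _)
      · intro x hx hxP
        obtain ⟨y, hy, hmin⟩ := (S.filter fun y => u y = u x).exists_min_image r
          ⟨x, by simp [hx]⟩
        obtain ⟨hyS, hyu⟩ := Finset.mem_filter.1 hy
        have hyP : y ∈ P := Finset.mem_filter.2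
          ⟨hyS, fun z hz hzu => hmin z (Finset.mem_filter.2 ⟨hz, hzu.trans hyu⟩)⟩
        have hxy : x ≠ y := fun h => hxP (h ▸ hyP)
        have h1 := hmin x (by simp [hx])
        have h2 := hr x hx y hyS hxy (Or.inl hyu.symm)
        exact ⟨y, hyP, Or.inl ⟨hyu.symm, by omega⟩⟩
    · push Not at hinj
      -- Otherwise two edges of `P` meet at a `w`-end, which prefers `x` to `y`. A kernel without
      -- `y` also dominates `y`: it contains `x`, or it dominates `x`, necessarily at the `w`-end
      -- since `x` is the favourite at its `u`-end.
      obtain ⟨x, y, hx, hy, hw, hxy⟩ : ∃ x y, x ∈ P ∧ y ∈ P ∧ w x = w y ∧ r y < r x := by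
        obtain ⟨x, hx, y, hy, hw, hne⟩ := hinj
        have := hr x (Finset.mem_filter.1 hx).1 y (Finset.mem_filter.1 hy).1 hne (Or.inr hw)
        rcases lt_or_gt_of_ne this with h | h
        · exact ⟨y, x, hy, hx, hw.symm, h⟩
        · exact ⟨x, y, hx, hy, hw, h⟩
      have hyS := (Finset.mem_filter.1 hy).1
      have hxS := (Finset.mem_filter.1 hx).1
      obtain ⟨M, hM, hind, hdom⟩ := ih (S.erase y) (Finset.erase_ssubset hyS)
        (fun a ha b hb => hr a (Finset.mem_of_mem_erase ha) b (Finset.mem_of_mem_erase hb))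
      refine ⟨M, hM.trans (Finset.erase_subset _ _), hind, fun z hz hzM => ?_⟩
      by_cases hzy : z = y
      · subst hzy
        by_cases hxM : x ∈ M
        · exact ⟨x, hxM, Or.inr ⟨hw.symm, hxy⟩⟩
        · obtain ⟨t, ht, h | h⟩ := hdom x (Finset.mem_erase.2 ⟨fun h => by simp [h] at hxy, hxS⟩) hxM
          · exact absurd ((Finset.mem_filter.1 hx).2 t (Finset.mem_of_mem_erase (hM ht)) h.1.symm)
              (by omega)
          · exact ⟨t, ht, Or.inr ⟨hw.symm.trans h.1, by omega⟩⟩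
      · exact hdom z (Finset.mem_erase.2 ⟨hzy, hz⟩) hzM

namespace EdgeList

/-- The `i`-th edge of a list. -/
def edge (E : List (ℕ × ℕ)) (i : ℕ) : ℕ × ℕ := E.getD i (0, 0)

/-- The indices of the edges with second end `< B`. -/
def outward (E : List (ℕ × ℕ)) (B : ℕ) : Finset ℕ :=
  (Finset.range E.length).filter fun i => (edge E i).2 < B

/-- The colour of the `i`-th edge in an auxiliary 3-edge-colouring. -/
def auxColor (E : List (ℕ × ℕ)) (s i : ℕ) : ℕ := ((edge E i).1 + (edge E i).2 + s) % 3

/-- The `j`-th edge precedes the `i`-th one in the preference order at a common end. -/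
def Yields (E : List (ℕ × ℕ)) (s i j : ℕ) : Prop :=
  ((edge E i).1 = (edge E j).1 ∧ auxColor E s j < auxColor E s i) ∨
    ((edge E i).2 = (edge E j).2 ∧ auxColor E s i < auxColor E s j)

instance (E : List (ℕ × ℕ)) (s : ℕ) : DecidableRel (Yields E s) :=
  fun _ _ => inferInstanceAs (Decidable (_ ∨ _))

/-- The edges to the boundary form a bipartite graph to which Galvin's method applies with the
given auxiliary colouring, and there is at most one other edge, which can be coloured last. -/
def GalvinCertifies (E : List (ℕ × ℕ)) (B k s : ℕ) : Prop :=
  Simple E ∧ (∀ i ∈ outward E B, ∀ j ∈ outward E B, i ≠ j →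
    (touch (edge E i) (edge E j) → (edge E i).1 = (edge E j).1 ∨ (edge E i).2 = (edge E j).2) ∧
    ((edge E i).1 = (edge E j).1 ∨ (edge E i).2 = (edge E j).2 →
      auxColor E s i ≠ auxColor E s j)) ∧
  (∀ i ∈ outward E B, ((outward E B).filter (Yields E s i)).card + k <
    capacity E B k (edge E i).1 + capacity E B k (edge E i).2) ∧
  ∀ i ∈ Finset.range E.length \ outward E B, (∀ j ∈ Finset.range E.length \ outward E B, j = i) ∧
    ((outward E B).filter fun j => touch (edge E i) (edge E j)).card + k <
      capacity E B k (edge E i).1 + capacity E B k (edge E i).2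

instance (E : List (ℕ × ℕ)) (B k s : ℕ) : Decidable (GalvinCertifies E B k s) :=
  inferInstanceAs (Decidable (_ ∧ _ ∧ _ ∧ _))

theorem touch_comm (e f : ℕ × ℕ) : touch e f = touch f e := by
  rw [Bool.eq_iff_iff]
  simp only [touch, Bool.or_eq_true, beq_iff_eq]
  omega

theorem flexible_of_galvinCertifies {E : List (ℕ × ℕ)} {B k s : ℕ}
    (h : GalvinCertifies E B k s) : Flexible E B k := by
  obtain ⟨h0, h1, h2, h3⟩ := h
  refine ⟨h0, ?_⟩
  have hedge : ∀ i (hi : i < E.length), edge E i = E[i] := fun i hi => by simp [edge, hi]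
  intro L hL
  have hL' : ∀ i < E.length,
      capacity E B k (edge E i).1 + capacity E B k (edge E i).2 ≤ (L i).card + k := fun i hi => by
    rw [hedge i hi]
    exact hL i hi
  have hlt : ∀ i ∈ outward E B, i < E.length := fun i hi =>
    Finset.mem_range.1 (Finset.mem_filter.1 hi).1
  obtain ⟨c, hc, hD⟩ := exists_coloring_of_kernels (Yields E s) (outward E B)
    (fun T hT => exists_kernel_of_bipartite (fun i => (edge E i).1) (fun i => (edge E i).2)
      (auxColor E s) T (fun x hx y hy hxy => (h1 x (hT hx) y (hT hy) hxy).2)) L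
    (fun i hi => by
      have := h2 i hi
      have := hL' i (hlt i hi)
      omega)
  have hproper : ∀ i ∈ outward E B, ∀ j ∈ outward E B, i ≠ j → touch (edge E i) (edge E j) →
      c i ≠ c j := by
    intro i hi j hj hij ht
    have h4 := (h1 i hi j hj hij).1 ht
    have h5 := (h1 i hi j hj hij).2 h4
    rcases h4 with h4 | h4 <;> rcases lt_or_gt_of_ne h5 with h6 | h6
    · exact (hD j hj i hi (Or.inl ⟨h4.symm, h6⟩)).symm
    · exact hD i hi j hj (Or.inl ⟨h4, h6⟩)
    · exact hD i hi j hj (Or.inr ⟨h4, h6⟩)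
    · exact (hD j hj i hi (Or.inr ⟨h4.symm, h6⟩)).symm
  have hex : ∀ i, i ∈ Finset.range E.length \ outward E B → ∃ a ∈ L i,
      ∀ j ∈ outward E B, touch (edge E i) (edge E j) → a ≠ c j := by
    intro i hi
    have h4 := (h3 i hi).2
    have h5 := hL' i (Finset.mem_range.1 (Finset.mem_sdiff.1 hi).1)
    have h6 : (((outward E B).filter fun j => touch (edge E i) (edge E j)).image c).card <
        (L i).card := Finset.card_image_le.trans_lt (by omega)
    obtain ⟨a, ha, hna⟩ := Finset.exists_mem_notMem_of_card_lt_card h6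
    refine ⟨a, ha, fun j hj ht haj => hna (Finset.mem_image.2 ⟨j, ?_, haj.symm⟩)⟩
    exact Finset.mem_filter.2 ⟨hj, ht⟩
  choose! d hd hdc using hex
  have hnot : ∀ i < E.length, i ∉ outward E B → i ∈ Finset.range E.length \ outward E B :=
    fun i hi hn => Finset.mem_sdiff.2 ⟨Finset.mem_range.2 hi, hn⟩
  refine ⟨fun i => if i ∈ outward E B then c i else d i, fun i hi => ?_, fun i j hj hij ht => ?_⟩
  · by_cases h : i ∈ outward E B
    · simpa [h] using hc i h
    · simpa [h] using hd i (hnot i hi h)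
  · rw [← hedge i (hij.trans hj), ← hedge j hj] at ht
    by_cases hi' : i ∈ outward E B <;> by_cases hj' : j ∈ outward E B
    · simpa [hi', hj'] using hproper i hi' j hj' hij.ne ht
    · rw [touch_comm] at ht
      simpa [hi', hj'] using (hdc j (hnot j hj hj') i hi' ht).symm
    · simpa [hi', hj'] using hdc i (hnot i (hij.trans hj) hi') j hj' ht
    · exact absurd ((h3 i (hnot i (hij.trans hj) hi')).1 j (hnot j hj hj')) hij.ne'

end EdgeList

/-! ### Flexibility of small stacked graphs -/

namespace Forest

open EdgeList

/-- The edges of the triangle `0, 1, 2`. -/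
def triangle : List (ℕ × ℕ) := [(0, 1), (1, 2), (0, 2)]

/-- The edges at the vertices of three forests stacked onto the triangles that the vertex `3`
spans with the sides of the triangle `0, 1, 2`. -/
def childEdges (t : Forest ℕ × Forest ℕ × Forest ℕ) : List (ℕ × ℕ) :=
  t.1.edges 3 1 2 ++ (t.2.1.edges 0 3 2 ++ t.2.2.edges 0 1 3)

/-- The edges at the vertex `3` stacked onto the triangle `0, 1, 2`, and at the vertices of three
forests stacked onto the triangles that `3` spans with its sides. -/
def branchEdges (t : Forest ℕ × Forest ℕ × Forest ℕ) : List (ℕ × ℕ) :=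
  (cons 3 t.1 t.2.1 t.2.2 nil).edges 0 1 2

/-- All triples of forests of given sizes with consecutive vertices, beginning with `s`. -/
def triples (s : ℕ) (n : ℕ × ℕ × ℕ) : List (Forest ℕ × Forest ℕ × Forest ℕ) :=
  (enum n.1 s).flatMap fun A => (enum n.2.1 (s + n.1)).flatMap fun B =>
    (enum n.2.2 (s + n.1 + n.2.1)).map fun C => (A, B, C)

/-- Each edge list is certified to be flexible by the corresponding code. -/
noncomputable def certifiesAll (B k : ℕ) : List (List (ℕ × ℕ)) → List ℕ → Bool
  | [], _ => true
  | _ :: _, [] => false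
  | E :: Es, n :: ns => certifies E B k n && certifiesAll B k Es ns

theorem flexible_of_certifiesAll {B k : ℕ} {Es : List (List (ℕ × ℕ))} {ns : List ℕ}
    (h : certifiesAll B k Es ns) : ∀ E ∈ Es, Flexible E B k := by
  induction Es generalizing ns with
  | nil => simp
  | cons E Es ih =>
    cases ns with
    | nil => simp [certifiesAll] at h
    | cons n ns =>
      rw [certifiesAll, Bool.and_eq_true_iff] at h
      intro E' hE'
      rcases List.mem_cons.1 hE' with rfl | hE'
      · exact flexible_of_certifies h.1
      · exact ih h.2 E' hE'

/-- Sizes of three forests of which those of size 2 are two, or of which one has size 2 and the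
others size 1. -/
def childSizes : List (ℕ × ℕ × ℕ) :=
  [(2, 2, 0), (2, 0, 2), (0, 2, 2), (2, 1, 1), (1, 2, 1), (1, 1, 2)]

/-- Sizes of three forests with 3 vertices in total and at most 2 in each. -/
def branchSizes : List (ℕ × ℕ × ℕ) :=
  [(2, 1, 0), (2, 0, 1), (1, 2, 0), (0, 2, 1), (1, 0, 2), (0, 1, 2), (1, 1, 1)]

/-- Sizes of three forests with 2 vertices in total. -/
def smallBranchSizes : List (ℕ × ℕ × ℕ) :=
  [(2, 0, 0), (0, 2, 0), (0, 0, 2), (1, 1, 0), (1, 0, 1), (0, 1, 1)]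

/-- The base 16 digits of the numbers are the exponents of suitable monomials, one number for each
edge list in the order of enumeration. How they were found is irrelevant, since `certifies`
recomputes the coefficients. The same holds for the tables below. -/
theorem flexible_childEdges :
    ∀ E ∈ (childSizes.flatMap (triples 4)).map childEdges, Flexible E 4 6 :=
  flexible_of_certifiesAll (ns :=
    [55058011075091, 38573925544466, 55058547941906, 54989358706963, 37461529015571,
     20981738448147, 37462065882386, 38492388267283, 56153227662163, 38573925470803,
     37466361832273, 56088869217105, 55053447668501, 37474145477141, 53959035261717,
     54989088170773, 56153225769251, 38573924622626, 55058545914146, 54989356740913,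
     56157251245363, 37474411947313, 55058544858403, 54989355689265, 55053445640531,
     37474144493906, 53959034216787, 54989088231763, 37461528092981, 20981738508597,
     37462064898341, 38492387221813, 54026713641251, 36511836942626, 35404809187633,
     54026747191586, 54018122659123, 36511835886883, 35404808135985, 36434560099633,
     36430232564051, 18850931355987, 35400514146643, 36430266114386, 54022401892661,
     36443100684581, 52928258842933, 53958027645237, 55053715120675, 37457233065251,
     53953934996051, 37461260640805, 54022939746835, 54018379555091, 36430485463570,
     53954203570706, 55122181955875, 37542880747810, 54027770536211, 55057807773986]) (by decide +kernel)

theorem flexible_branchEdges :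
    ∀ E ∈ (branchSizes.flatMap (triples 4)).map branchEdges, Flexible E 3 6 :=
  flexible_of_certifiesAll (ns :=
    [55058546971429, 37462065960229, 53954741359445, 36298130871077, 38573925618229,
     20981470156085, 37474145555029, 36306182951477, 54027771781909, 36431293915669,
     54023477854997, 53954741621525, 36511838122579, 18915356128595, 1323171131987,
     36443101930069, 21050210591029, 21050210582837, 19950699094309, 20981474349365,
     20015140188499, 19881996202067, 18915360321875, 19950698910034, 37542881993253]) (by decide +kernel)

theorem flexible_smallBranchEdges_seven :
    ∀ E ∈ (smallBranchSizes.flatMap (triples 4)).map branchEdges, Flexible E 3 7 :=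
  flexible_of_certifiesAll (ns :=
    [9128006182, 4833039398, 8860553798, 9128006181, 8624874082, 4329907298, 8624874066,
     8609141333, 575743522, 575743266, 307307858, 559027493, 8877576726, 4853993766, 4602274146]) (by decide +kernel)

/-- For degree bound 6 the edges of the triangle are recoloured as well, which gives additional
freedom. This version is not monotone in `k`, because the triangle edges have both ends on the
boundary; larger bounds are covered by `flexible_smallBranchEdges_seven`. -/
theorem flexible_smallBranchEdges_six :
    ∀ E ∈ (smallBranchSizes.flatMap (triples 4)).map (fun t => branchEdges t ++ triangle),
      Flexible E 3 6 :=
  flexible_of_certifiesAll (ns :=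
    [20909011522629, 2281738360133, 19809232442453, 19805205976133, 53893857100884,
     35266583938388, 53885268214868, 36301655323733, 1315406300484, 1246418453828,
     17739092804948, 1246670107973, 37401435386933, 2350476702533, 35335573816148]) (by decide +kernel)

/-- The first vertex of the forest carries at most one vertex, and is followed by a forest with
at most two vertices. -/
def IsNarrow : Forest ℕ → Bool
  | nil => false
  | cons _ A B C R => A.size + B.size + C.size ≤ 1 && R.size ≤ 2

/-- Alon–Tarsi cannot cover all cases here. Three vertices on the same triangle give K₃,₃ with lists
of size 3; the only monomial of the right degree has all exponents 2, and its coefficient vanishes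
because even and odd Latin squares of order 3 cancel. Galvin's method works, for a suitable shift
`s` of the auxiliary colours. -/
theorem flexible_narrow_three :
    ∀ F ∈ enum 3 3, F.IsNarrow → Flexible (F.edges 0 1 2) 3 6 := by
  have h : ∀ F ∈ enum 3 3, F.IsNarrow → ∃ s < 3, GalvinCertifies (F.edges 0 1 2) 3 6 s := by
    decide +kernel
  intro F hF hn
  obtain ⟨s, -, hs⟩ := h F hF hn
  exact flexible_of_galvinCertifies hs

theorem flexible_narrow_four :
    ∀ E ∈ ((enum 4 3).filter IsNarrow).map (fun F => F.edges 0 1 2), Flexible E 3 6 :=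
  flexible_of_certifiesAll (ns :=
    [20900168742195, 21050223179011, 37599537276195, 38629826233650, 55195196207955,
     37542898577490, 54096507708241, 55126527181650, 56217669075765, 38642661851445,
     55127282033445, 56157320254261]) (by decide +kernel)

/-- With no boundary vertices every capacity is `k`, so flexibility is choosability of the whole
graph from lists of size `k`. -/
theorem flexible_whole_six :
    ∀ E ∈ (enum 0 3 ++ enum 1 3 ++ enum 2 3).map (fun F => F.edges 0 1 2 ++ triangle),
      Flexible E 0 6 :=
  flexible_of_certifiesAll (ns :=
    [18, 74292, 304300869, 304300869, 304300869, 304300869]) (by decide +kernel)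

theorem flexible_whole_five :
    ∀ E ∈ (enum 2 3 ++ enum 3 3).map (fun F => F.edges 0 1 2 ++ triangle), Flexible E 0 5 :=
  flexible_of_certifiesAll (ns :=
    [17486316609, 13458486324, 13961008164, 17217897504, 39875603858244, 3586888320068,
     55058060559428, 57458126238788, 74922553771073, 75051370299444, 74922537993248,
     57467739583538, 39875618549828, 39871326721073, 55268230825028, 75055698813954,
     74836101841988, 57454902789188, 39871325683988, 4545220715588, 56294426035268,
     56222267229248, 74982411682884, 73891762607108, 73955901915203, 73959941882948]) (by decide +kernel)

theorem flexible_whole_three :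
    ∀ E ∈ (enum 1 3).map (fun F => F.edges 0 1 2 ++ triangle), Flexible E 0 3 :=
  flexible_of_certifiesAll (ns :=
    [2236962]) (by decide +kernel)

end Forest

/-! ### List edge-colourings of finite sets of edges -/

section ListColoring

variable {V : Type*}

/-- The edges of `E` can be coloured from the lists `L`, adjacent edges differently. -/
def ListColorable (E : Finset (Sym2 V)) (L : Sym2 V → Set ℕ) : Prop :=
  ∃ C : Sym2 V → ℕ, (∀ e ∈ E, C e ∈ L e) ∧
    ∀ e ∈ E, ∀ f ∈ E, e ≠ f → ∀ v, v ∈ e → v ∈ f → C e ≠ C f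

theorem ListColorable.mono {E E' : Finset (Sym2 V)} {L : Sym2 V → Set ℕ} (hE : E' ⊆ E)
    (h : ListColorable E L) : ListColorable E' L := by
  obtain ⟨C, hC, hp⟩ := h
  exact ⟨C, fun e he => hC e (hE he), fun e he f hf => hp e (hE he) f (hE hf)⟩

variable [DecidableEq V]

/-- The number of edges of `E` at `u`. -/
def edgeDegree (E : Finset (Sym2 V)) (u : V) : ℕ := (E.filter (u ∈ ·)).card

theorem edgeDegree_mono {E E' : Finset (Sym2 V)} (h : E' ⊆ E) (u : V) :
    edgeDegree E' u ≤ edgeDegree E u :=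
  Finset.card_le_card (Finset.filter_subset_filter _ h)

/-- The unordered pairs of a list. -/
def edgeFinset (E : List (V × V)) : Finset (Sym2 V) := (E.map fun e => s(e.1, e.2)).toFinset

theorem mem_edgeFinset {E : List (V × V)} {e : Sym2 V} :
    e ∈ edgeFinset E ↔ ∃ p ∈ E, s(p.1, p.2) = e := by
  simp [edgeFinset]

theorem edgeFinset_append (E F : List (V × V)) :
    edgeFinset (E ++ F) = edgeFinset E ∪ edgeFinset F := by
  simp [edgeFinset]

theorem exists_finset_subset_of_le_encard {s : Set ℕ} {k : ℕ} (h : (k : ℕ∞) ≤ s.encard) :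
    ∃ t : Finset ℕ, (t : Set ℕ) ⊆ s ∧ t.card = k := by
  obtain ⟨t, ht, hk⟩ := Set.exists_subset_encard_eq h
  have hfin : t.Finite := Set.finite_of_encard_eq_coe hk
  refine ⟨hfin.toFinset, by simpa using ht, ?_⟩
  rw [hfin.encard_eq_coe_toFinset_card] at hk
  exact_mod_cast hk

theorem nodup_map_of_simple {l : List V} {E : List (V × V)}
    (hsimple : EdgeList.Simple (E.map (Prod.map l.idxOf l.idxOf))) :
    (E.map fun e => s(e.1, e.2)).Nodup := by
  rw [List.Nodup, List.pairwise_map]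
  rw [EdgeList.Simple, List.pairwise_map] at hsimple
  refine hsimple.imp fun {e f} h h' => h ?_
  have := congrArg (Sym2.map l.idxOf) h'
  simpa using this

theorem degree_map_idxOf_le {l : List V} {E : List (V × V)} (hE : ∀ e ∈ E, e.1 ∈ l ∧ e.2 ∈ l)
    (hsimple : EdgeList.Simple (E.map (Prod.map l.idxOf l.idxOf))) (u : V) :
    EdgeList.degree (E.map (Prod.map l.idxOf l.idxOf)) (l.idxOf u) ≤
      edgeDegree (edgeFinset E) u := by
  have h1 : (edgeFinset E).filter (u ∈ ·) =
      ((E.map fun e => s(e.1, e.2)).filter (u ∈ ·)).toFinset := by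
    ext e
    simp [edgeFinset]
  rw [edgeDegree, h1, List.toFinset_card_of_nodup ((nodup_map_of_simple hsimple).filter _),
    ← List.countP_eq_length_filter, EdgeList.degree, List.countP_map, List.countP_map]
  refine List.countP_mono_left fun e he h => ?_
  simp only [Function.comp, Prod.map, Bool.or_eq_true, beq_iff_eq] at h
  simp only [Function.comp, decide_eq_true_eq, Sym2.mem_iff]
  exact h.imp (fun h => ((List.idxOf_inj (hE e he).1).1 h).symm)
    fun h => ((List.idxOf_inj (hE e he).2).1 h).symm

open EdgeList in
/-- Extending a list edge-colouring to the edges of a flexible list. The first `B` vertices of `l`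
are those which may be shared with the edges coloured before. -/
theorem ListColorable.extend {l : List V} {B k : ℕ} {E : List (V × V)}
    (hE : ∀ e ∈ E, e.1 ∈ l ∧ e.2 ∈ l) (hflex : Flexible (E.map (Prod.map l.idxOf l.idxOf)) B k)
    {S : Finset (Sym2 V)} (hS : ∀ x ∈ l.drop B, ∀ e ∈ S, x ∉ e)
    (hdisj : Disjoint S (edgeFinset E)) (hdeg : ∀ u, edgeDegree (S ∪ edgeFinset E) u ≤ k)
    {L : Sym2 V → Set ℕ} (hL : ∀ e ∈ edgeFinset E, (k : ℕ∞) ≤ (L e).encard)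
    (hcol : ListColorable S L) : ListColorable (S ∪ edgeFinset E) L := by
  classical
  obtain ⟨hsimple, hflex⟩ := hflex
  obtain ⟨C, hCL, hCp⟩ := hcol
  set E' := E.map fun e => s(e.1, e.2) with hE'
  have hlen : E'.length = E.length := by simp [hE']
  have hmem : ∀ i (hi : i < E.length), s(E[i].1, E[i].2) ∈ edgeFinset E := fun i hi =>
    mem_edgeFinset.2 ⟨E[i], List.getElem_mem hi, rfl⟩
  -- The colours at `u` forbidden by `S` number at most `k` minus the capacity of `u`: by the degree
  -- bound at a boundary vertex, and because no edge of `S` reaches any other vertex of `l`.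
  -- Removing the forbidden colours at both ends from `k` colours leaves what `Flexible` demands.
  have hout : ∀ u ∈ l, capacity (E.map (Prod.map l.idxOf l.idxOf)) B k (l.idxOf u) +
      edgeDegree S u ≤ k := by
    intro u hu
    unfold capacity
    split_ifs with hB
    · refine le_trans ?_ (hdeg u)
      rw [edgeDegree, edgeDegree, Finset.filter_union, Finset.card_union_of_disjoint
        (Finset.disjoint_filter_filter hdisj), add_comm, add_le_add_iff_left]
      exact degree_map_idxOf_le hE hsimple u
    · have h1 : u ∈ l.drop B := by
        rw [List.mem_drop_iff_getElem]
        have h2 := List.idxOf_lt_length_iff.2 hu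
        exact ⟨l.idxOf u - B, by omega, by simp [show B + (l.idxOf u - B) = l.idxOf u by omega]⟩
      have h2 : edgeDegree S u = 0 := by
        rw [edgeDegree, Finset.card_eq_zero, Finset.filter_eq_empty_iff]
        exact fun e he => hS u h1 e he
      omega
  have hT : ∀ i, ∃ t : Finset ℕ, ∀ hi : i < E.length,
      (t : Set ℕ) ⊆ L s(E[i].1, E[i].2) ∧ t.card = k := by
    intro i
    by_cases hi : i < E.length
    · obtain ⟨t, ht⟩ := exists_finset_subset_of_le_encard (hL _ (hmem i hi))
      exact ⟨t, fun _ => ht⟩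
    · exact ⟨∅, fun h => absurd h hi⟩
  choose T hT using hT
  set U : V → Finset ℕ := fun u => (S.filter (u ∈ ·)).image C with hU
  have hUcard : ∀ u, (U u).card ≤ edgeDegree S u := fun u => Finset.card_image_le
  obtain ⟨c, hcL, hcp⟩ := hflex
    (fun i => if hi : i < E.length then (T i \ U E[i].1) \ U E[i].2 else ∅) (fun i hi => by
      have hi' : i < E.length := by simpa using hi
      have h1 := hout _ (hE _ (List.getElem_mem hi')).1
      have h2 := hout _ (hE _ (List.getElem_mem hi')).2
      have h3 := Finset.le_card_sdiff (U E[i].1) (T i)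
      have h4 := Finset.le_card_sdiff (U E[i].2) (T i \ U E[i].1)
      have h5 := hUcard E[i].1
      have h6 := hUcard E[i].2
      rw [(hT i hi').2] at h3
      simp only [List.getElem_map, Prod.map, hi', dif_pos]
      omega)
  simp only [List.length_map] at hcL hcp
  have hidx : ∀ e ∈ edgeFinset E, ∃ i, ∃ hi : i < E.length, s(E[i].1, E[i].2) = e ∧
      E'.idxOf e = i := by
    intro e he
    have he' : e ∈ E' := List.mem_toFinset.1 he
    have h1 := List.idxOf_lt_length_iff.2 he'
    refine ⟨E'.idxOf e, hlen ▸ h1, ?_, rfl⟩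
    exact (List.getElem_map (fun e : V × V => s(e.1, e.2)) (h := h1)).symm.trans
      (List.getElem_idxOf h1)
  have hmixed : ∀ e ∈ S, ∀ f ∈ edgeFinset E, ∀ v, v ∈ e → v ∈ f → C e ≠ c (E'.idxOf f) := by
    intro e he f hf v hve hvf heq
    obtain ⟨i, hi, rfl, hidxi⟩ := hidx f hf
    have h1 := hcL i hi
    rw [hidxi] at heq
    rw [dif_pos hi, ← heq] at h1
    have h2 : C e ∈ U v := Finset.mem_image.2 ⟨e, Finset.mem_filter.2 ⟨he, hve⟩, rfl⟩
    simp only [Finset.mem_sdiff] at h1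
    rcases Sym2.mem_iff.1 hvf with rfl | rfl
    · exact h1.1.2 h2
    · exact h1.2 h2
  have hconf : ∀ e ∈ edgeFinset E, ∀ f ∈ edgeFinset E, E'.idxOf e < E'.idxOf f → ∀ v, v ∈ e →
      v ∈ f → c (E'.idxOf e) ≠ c (E'.idxOf f) := by
    intro e he f hf hlt v hve hvf
    obtain ⟨i, hi, rfl, hidxi⟩ := hidx e he
    obtain ⟨j, hj, rfl, hidxj⟩ := hidx f hf
    rw [hidxi, hidxj] at hlt ⊢
    refine hcp i j hj hlt ?_
    simp only [List.getElem_map, Prod.map, touch, Bool.or_eq_true, beq_iff_eq]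
    rcases Sym2.mem_iff.1 hve with h1 | h1 <;> rcases Sym2.mem_iff.1 hvf with h2 | h2 <;>
      simp [← h1, ← h2]
  refine ⟨fun e => if e ∈ S then C e else c (E'.idxOf e), fun e he => ?_,
    fun e he f hf hef v hve hvf => ?_⟩
  · by_cases h : e ∈ S
    · simpa [h] using hCL e h
    · have he' := (Finset.mem_union.1 he).resolve_left h
      obtain ⟨i, hi, rfl, hidxi⟩ := hidx e he'
      have h1 := hcL i hi
      rw [dif_pos hi] at h1
      simp only [h, if_false, hidxi]
      exact (hT i hi).1 (Finset.sdiff_subset (Finset.sdiff_subset h1))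
  · by_cases h1 : e ∈ S <;> by_cases h2 : f ∈ S
    · simpa [h1, h2] using hCp e h1 f h2 hef v hve hvf
    · simpa [h1, h2] using hmixed e h1 f ((Finset.mem_union.1 hf).resolve_left h2) v hve hvf
    · simpa [h1, h2] using (hmixed f h2 e ((Finset.mem_union.1 he).resolve_left h1) v hvf hve).symm
    · have he' := (Finset.mem_union.1 he).resolve_left h1
      have hf' := (Finset.mem_union.1 hf).resolve_left h2
      have hne : E'.idxOf e ≠ E'.idxOf f := fun h => by
        obtain ⟨i, hi, rfl, hidxi⟩ := hidx e he'
        obtain ⟨j, hj, rfl, hidxj⟩ := hidx f hf'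
        have hij : i = j := hidxi.symm.trans (h.trans hidxj)
        subst hij
        exact hef rfl
      rcases lt_or_gt_of_ne hne with h | h
      · simpa [h1, h2] using hconf e he' f hf' h v hve hvf
      · simpa [h1, h2] using (hconf f hf' e he' h v hvf hve).symm

end ListColoring

/-! ### Relabelling forests by numbers, and completeness of the enumeration -/

namespace Forest

variable {V : Type*}

/-- Relabelling of the vertices of a forest. -/
def map {W : Type*} (g : V → W) : Forest V → Forest W
  | nil => nil
  | cons v A B C R => cons (g v) (A.map g) (B.map g) (C.map g) (R.map g)

theorem verts_map {W : Type*} (g : V → W) (F : Forest V) : (F.map g).verts = F.verts.map g := by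
  induction F with
  | nil => rfl
  | cons v A B C R hA hB hC hR => simp [map, verts, hA, hB, hC, hR]

theorem edges_map {W : Type*} (g : V → W) (F : Forest V) (a b c : V) :
    (F.map g).edges (g a) (g b) (g c) = (F.edges a b c).map (Prod.map g g) := by
  induction F generalizing a b c with
  | nil => rfl
  | cons v A B C R hA hB hC hR => simp [map, edges, hA, hB, hC, hR]

theorem size_map {W : Type*} (g : V → W) (F : Forest V) : (F.map g).size = F.size := by
  induction F with
  | nil => rfl
  | cons v A B C R hA hB hC hR => simp [map, size, hA, hB, hC, hR]

theorem length_verts (F : Forest V) : F.verts.length = F.size := by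
  induction F with
  | nil => rfl
  | cons v A B C R hA hB hC hR => simp [verts, size, hA, hB, hC, hR]; ring

theorem fst_mem_verts_of_mem_edges {F : Forest V} {a b c : V} {e : V × V}
    (he : e ∈ F.edges a b c) : e.1 ∈ F.verts := by
  induction F generalizing a b c with
  | nil => simp [edges] at he
  | cons v A B C R hA hB hC hR =>
    simp only [edges, List.mem_append, List.mem_cons] at he
    simp only [verts, List.mem_cons, List.mem_append]
    rcases he with he | he | he | rfl | rfl | rfl | he
    · exact Or.inr (Or.inl (hA he))
    · exact Or.inr (Or.inr (Or.inl (hB he)))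
    · exact Or.inr (Or.inr (Or.inr (Or.inl (hC he))))
    · exact Or.inl rfl
    · exact Or.inl rfl
    · exact Or.inl rfl
    · exact Or.inr (Or.inr (Or.inr (Or.inr (hR he))))

theorem snd_mem_of_mem_edges {F : Forest V} {a b c : V} {e : V × V}
    (he : e ∈ F.edges a b c) : e.2 ∈ a :: b :: c :: F.verts := by
  induction F generalizing a b c with
  | nil => simp [edges] at he
  | cons v A B C R hA hB hC hR =>
    simp only [edges, List.mem_append, List.mem_cons] at he
    simp only [verts, List.mem_cons, List.mem_append] at hA hB hC hR ⊢
    rcases he with he | he | he | rfl | rfl | rfl | he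
    · have := hA he; tauto
    · have := hB he; tauto
    · have := hC he; tauto
    · simp
    · simp
    · simp
    · have := hR he; tauto

theorem length_edges (F : Forest V) (a b c : V) : (F.edges a b c).length = 3 * F.size := by
  induction F generalizing a b c with
  | nil => rfl
  | cons v A B C R hA hB hC hR =>
    simp only [edges, size, List.length_append, List.length_cons, hA, hB, hC, hR]
    ring

theorem mem_of_mem_edges_append {a b c : V} {F : Forest V} {e : V × V}
    (he : e ∈ F.edges a b c ++ [(a, b), (b, c), (a, c)]) :
    e.1 ∈ a :: b :: c :: F.verts ∧ e.2 ∈ a :: b :: c :: F.verts := by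
  rcases List.mem_append.1 he with he | he
  · have h6 := fst_mem_verts_of_mem_edges he
    exact ⟨by simp [h6], snd_mem_of_mem_edges he⟩
  · simp only [List.mem_cons, List.not_mem_nil, or_false] at he
    rcases he with rfl | rfl | rfl <;> simp

/-- Under the numbering in the order of `verts`, the four subforests occupy consecutive intervals
whose starting points are determined by the sizes. Hence each shape needs to be listed only once. -/
theorem mem_enum_go {F : Forest ℕ} {d s : ℕ} (hd : F.size ≤ d)
    (hF : F.verts = List.range' s F.size) : F ∈ enum.go d F.size s := by
  induction F generalizing d s with
  | nil => cases d <;> simp [enum.go, size]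
  | cons v A B C R hA hB hC hR =>
    obtain ⟨d, rfl⟩ : ∃ e, d = e + 1 := ⟨d - 1, by simp only [size] at hd; omega⟩
    simp only [size] at hd hF ⊢
    simp only [verts, List.range'_succ, List.cons.injEq] at hF
    obtain ⟨rfl, hF⟩ := hF
    rw [show A.size + B.size + C.size + R.size = A.size + (B.size + (C.size + R.size)) by ring,
      ← List.range'_append_1, ← List.range'_append_1, ← List.range'_append_1] at hF
    obtain ⟨h1, hF⟩ := List.append_inj hF (by simp [length_verts])
    obtain ⟨h2, hF⟩ := List.append_inj hF (by simp [length_verts])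
    obtain ⟨h3, h4⟩ := List.append_inj hF (by simp [length_verts])
    simp only [enum.go, List.mem_flatMap, List.mem_range, List.mem_map]
    refine ⟨A.size, by omega, B.size, by omega, C.size, by omega, A, hA (by omega) h1,
      B, hB (by omega) h2, C, hC (by omega) h3, R, ?_, rfl⟩
    rw [show A.size + B.size + C.size + R.size - A.size - B.size - C.size = R.size by omega]
    exact hR (by omega) h4

theorem mem_enum {F : Forest ℕ} {s : ℕ} (hF : F.verts = List.range' s F.size) :
    F ∈ enum F.size s := mem_enum_go le_rfl hF

variable [DecidableEq V]

theorem map_idxOf_segment {pre mid post : List V} (h : (pre ++ (mid ++ post)).Nodup) :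
    mid.map (pre ++ (mid ++ post)).idxOf = List.range' pre.length mid.length := by
  refine List.ext_getElem (by simp) fun i h1 h2 => ?_
  have h3 : i < mid.length := by simpa using h1
  have h4 : pre.length + i < (pre ++ (mid ++ post)).length := by simp; omega
  have h5 := h.idxOf_getElem (pre.length + i) h4
  rw [List.getElem_append_right (by omega)] at h5
  simp only [Nat.add_sub_cancel_left, List.getElem_append_left h3] at h5
  simpa using h5

theorem map_idxOf_mem_enum {F : Forest V} {pre post : List V}
    (h : (pre ++ (F.verts ++ post)).Nodup) :
    F.map (pre ++ (F.verts ++ post)).idxOf ∈ enum F.size pre.length := by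
  have h1 := map_idxOf_segment h
  rw [← verts_map, length_verts] at h1
  have h2 := size_map (pre ++ (F.verts ++ post)).idxOf F
  have h3 := mem_enum (F := F.map (pre ++ (F.verts ++ post)).idxOf) (s := pre.length)
    (by rw [h1, h2])
  rwa [h2] at h3

/-- The set of edges at the vertices of a forest stacked onto a triangle. -/
def edgeSet (F : Forest V) (a b c : V) : Finset (Sym2 V) := edgeFinset (F.edges a b c)

/-- The edges from `v` to the vertices of a triangle. -/
def spokes (v a b c : V) : Finset (Sym2 V) := {s(v, a), s(v, b), s(v, c)}

/-- The edges of a triangle. -/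
def triangleEdges (a b c : V) : Finset (Sym2 V) := {s(a, b), s(b, c), s(a, c)}

theorem edgeSet_nil (a b c : V) : (nil : Forest V).edgeSet a b c = ∅ := by
  simp [edgeSet, edgeFinset, edges]

theorem edgeSet_cons (v : V) (A B C R : Forest V) (a b c : V) :
    (cons v A B C R).edgeSet a b c = spokes v a b c ∪ A.edgeSet v b c ∪ B.edgeSet a v c ∪
      C.edgeSet a b v ∪ R.edgeSet a b c := by
  have h : edgeFinset ((v, a) :: (v, b) :: (v, c) :: R.edges a b c) =
      spokes v a b c ∪ R.edgeSet a b c := by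
    ext e
    simp [edgeFinset, spokes, edgeSet]
  simp only [edgeSet, edges, edgeFinset_append, h]
  ext e
  simp only [Finset.mem_union]
  tauto

theorem mem_of_mem_edgeSet {F : Forest V} {a b c : V} {e : Sym2 V} (he : e ∈ F.edgeSet a b c)
    {x : V} (hx : x ∈ e) : x ∈ a :: b :: c :: F.verts := by
  obtain ⟨p, hp, rfl⟩ := mem_edgeFinset.1 he
  rcases Sym2.mem_iff.1 hx with rfl | rfl
  · have := fst_mem_verts_of_mem_edges hp
    simp [this]
  · exact snd_mem_of_mem_edges hp

end Forest

/-! ### Reducibility and its inheritance from subforests -/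

namespace Forest

open EdgeList

variable {V : Type*} [DecidableEq V]

/-- Some vertices of the forest `F` can be deleted such that each list edge-colouring of the
remaining graph, of maximum degree at most `k`, gives rise to one of the whole graph. The edges
`S` are those of the graph not at vertices of `F`. -/
def Reducible (k : ℕ) (F : Forest V) (a b c : V) : Prop :=
  ∃ F' : Forest V, F'.verts.Sublist F.verts ∧ F'.size < F.size ∧
    F'.edgeSet a b c ⊆ F.edgeSet a b c ∧
    ∀ (S : Finset (Sym2 V)) (L : Sym2 V → Set ℕ), (a :: b :: c :: F.verts).Nodup →
      triangleEdges a b c ⊆ S → (∀ e ∈ S, ∀ x ∈ F.verts, x ∉ e) →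
      (∀ u, edgeDegree (S ∪ F.edgeSet a b c) u ≤ k) →
      (∀ e ∈ S ∪ F.edgeSet a b c, (k : ℕ∞) ≤ (L e).encard) →
      ListColorable (S ∪ F'.edgeSet a b c) L → ListColorable (S ∪ F.edgeSet a b c) L

/-- Reducibility of `X` holds for every outer edge set, so the edges `K` of the larger forest
outside `X` can be absorbed into `S`. The triangle below `X` has its edges in the old triangle and
`K`. -/
theorem Reducible.lift {k : ℕ} {X : Forest V} {p q r a b c : V} (hX : X.Reducible k p q r)
    (mk : Forest V → Forest V) (K : Finset (Sym2 V))
    (hK : ∀ Y, (mk Y).edgeSet a b c = K ∪ Y.edgeSet p q r)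
    (hverts : ∀ Y, Y.verts.Sublist X.verts → (mk Y).verts.Sublist (mk X).verts)
    (hsize : ∀ Y, Y.size < X.size → (mk Y).size < (mk X).size)
    (hmem : ∀ x ∈ X.verts, x ∈ (mk X).verts)
    (hnodup : (a :: b :: c :: (mk X).verts).Nodup → (p :: q :: r :: X.verts).Nodup)
    (hKX : (a :: b :: c :: (mk X).verts).Nodup → ∀ e ∈ K, ∀ x ∈ X.verts, x ∉ e)
    (htri : triangleEdges p q r ⊆ triangleEdges a b c ∪ K) : (mk X).Reducible k a b c := by
  obtain ⟨Y, hYv, hYs, hYe, hY⟩ := hX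
  refine ⟨mk Y, hverts Y hYv, hsize Y hYs, ?_, fun S L hn hS hout hdeg hL hcol => ?_⟩
  · rw [hK, hK]
    exact Finset.union_subset_union_right hYe
  · rw [hK, ← Finset.union_assoc] at hcol hdeg hL ⊢
    refine hY (S ∪ K) L (hnodup hn) (htri.trans (Finset.union_subset_union_left hS)) ?_ hdeg hL hcol
    intro e he x hx
    rcases Finset.mem_union.1 he with he | he
    · exact hout e he x (hmem x hx)
    · exact hKX hn e he x hx

theorem notMem_of_mem_spokes {v a b c x : V} (hx : x ≠ v ∧ x ≠ a ∧ x ≠ b ∧ x ≠ c) {e : Sym2 V}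
    (he : e ∈ spokes v a b c) : x ∉ e := by
  simp only [spokes, Finset.mem_insert, Finset.mem_singleton] at he
  rcases he with rfl | rfl | rfl <;> simp [hx]

theorem notMem_of_mem_edgeSet {F : Forest V} {a b c x : V} (hx : x ∉ a :: b :: c :: F.verts)
    {e : Sym2 V} (he : e ∈ F.edgeSet a b c) : x ∉ e := fun h => hx (mem_of_mem_edgeSet he h)

theorem Reducible.cons_first {k : ℕ} {v a b c : V} {A B C R : Forest V}
    (h : A.Reducible k v b c) : (cons v A B C R).Reducible k a b c := by
  refine h.lift (fun Y => cons v Y B C R)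
    (spokes v a b c ∪ B.edgeSet a v c ∪ C.edgeSet a b v ∪ R.edgeSet a b c) (fun Y => ?_)
    (fun Y hY => ?_) (fun Y hY => ?_) (fun x hx => ?_) (fun hn => ?_) (fun hn => ?_) ?_
  · rw [edgeSet_cons]
    ext e
    simp only [Finset.mem_union]
    tauto
  · simp only [verts]
    exact (hY.append_right _).cons_cons _
  · simp only [size]
    omega
  · simp [verts, hx]
  · simp only [verts, List.nodup_cons, List.mem_cons, List.mem_append, List.nodup_append] at hn ⊢
    grind
  · intro e he x hx
    simp only [verts, List.nodup_cons, List.mem_cons, List.mem_append, List.nodup_append] at hn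
    simp only [Finset.mem_union] at he
    rcases he with ((he | he) | he) | he
    · exact notMem_of_mem_spokes (by grind) he
    · exact notMem_of_mem_edgeSet (by grind) he
    · exact notMem_of_mem_edgeSet (by grind) he
    · exact notMem_of_mem_edgeSet (by grind) he
  · intro e he
    simp only [triangleEdges, spokes, Finset.mem_union, Finset.mem_insert, Finset.mem_singleton,
      Sym2.eq_swap (a := v)] at he ⊢
    tauto

theorem Reducible.cons_second {k : ℕ} {v a b c : V} {A B C R : Forest V}
    (h : B.Reducible k a v c) : (cons v A B C R).Reducible k a b c := by
  refine h.lift (fun Y => cons v A Y C R)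
    (spokes v a b c ∪ A.edgeSet v b c ∪ C.edgeSet a b v ∪ R.edgeSet a b c) (fun Y => ?_)
    (fun Y hY => ?_) (fun Y hY => ?_) (fun x hx => ?_) (fun hn => ?_) (fun hn => ?_) ?_
  · rw [edgeSet_cons]
    ext e
    simp only [Finset.mem_union]
    tauto
  · simp only [verts]
    exact ((hY.append_right _).append_left _).cons_cons _
  · simp only [size]
    omega
  · simp [verts, hx]
  · simp only [verts, List.nodup_cons, List.mem_cons, List.mem_append, List.nodup_append] at hn ⊢
    grind
  · intro e he x hx
    simp only [verts, List.nodup_cons, List.mem_cons, List.mem_append, List.nodup_append] at hn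
    simp only [Finset.mem_union] at he
    rcases he with ((he | he) | he) | he
    · exact notMem_of_mem_spokes (by grind) he
    · exact notMem_of_mem_edgeSet (by grind) he
    · exact notMem_of_mem_edgeSet (by grind) he
    · exact notMem_of_mem_edgeSet (by grind) he
  · intro e he
    simp only [triangleEdges, spokes, Finset.mem_union, Finset.mem_insert, Finset.mem_singleton,
      Sym2.eq_swap (a := v)] at he ⊢
    tauto

theorem Reducible.cons_third {k : ℕ} {v a b c : V} {A B C R : Forest V}
    (h : C.Reducible k a b v) : (cons v A B C R).Reducible k a b c := by
  refine h.lift (fun Y => cons v A B Y R)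
    (spokes v a b c ∪ A.edgeSet v b c ∪ B.edgeSet a v c ∪ R.edgeSet a b c) (fun Y => ?_)
    (fun Y hY => ?_) (fun Y hY => ?_) (fun x hx => ?_) (fun hn => ?_) (fun hn => ?_) ?_
  · rw [edgeSet_cons]
    ext e
    simp only [Finset.mem_union]
    tauto
  · simp only [verts]
    exact (((hY.append_right _).append_left _).append_left _).cons_cons _
  · simp only [size]
    omega
  · simp [verts, hx]
  · simp only [verts, List.nodup_cons, List.mem_cons, List.mem_append, List.nodup_append] at hn ⊢
    grind
  · intro e he x hx
    simp only [verts, List.nodup_cons, List.mem_cons, List.mem_append, List.nodup_append] at hn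
    simp only [Finset.mem_union] at he
    rcases he with ((he | he) | he) | he
    · exact notMem_of_mem_spokes (by grind) he
    · exact notMem_of_mem_edgeSet (by grind) he
    · exact notMem_of_mem_edgeSet (by grind) he
    · exact notMem_of_mem_edgeSet (by grind) he
  · intro e he
    simp only [triangleEdges, spokes, Finset.mem_union, Finset.mem_insert, Finset.mem_singleton,
      Sym2.eq_swap (a := v)] at he ⊢
    tauto

theorem Reducible.cons_rest {k : ℕ} {v a b c : V} {A B C R : Forest V}
    (h : R.Reducible k a b c) : (cons v A B C R).Reducible k a b c := by
  refine h.lift (fun Y => cons v A B C Y)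
    (spokes v a b c ∪ A.edgeSet v b c ∪ B.edgeSet a v c ∪ C.edgeSet a b v) (fun Y => ?_)
    (fun Y hY => ?_) (fun Y hY => ?_) (fun x hx => ?_) (fun hn => ?_) (fun hn => ?_) ?_
  · rw [edgeSet_cons]
  · simp only [verts]
    exact (((hY.append_left _).append_left _).append_left _).cons_cons _
  · simp only [size]
    omega
  · simp [verts, hx]
  · simp only [verts, List.nodup_cons, List.mem_cons, List.mem_append, List.nodup_append] at hn ⊢
    grind
  · intro e he x hx
    simp only [verts, List.nodup_cons, List.mem_cons, List.mem_append, List.nodup_append] at hn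
    simp only [Finset.mem_union] at he
    rcases he with ((he | he) | he) | he
    · exact notMem_of_mem_spokes (by grind) he
    · exact notMem_of_mem_edgeSet (by grind) he
    · exact notMem_of_mem_edgeSet (by grind) he
    · exact notMem_of_mem_edgeSet (by grind) he
  · exact Finset.subset_union_left

/-- Deleting vertices whose edges form a flexible list, possibly after uncolouring the edges `T` of
the triangle. -/
theorem reducible_of_flexible {k : ℕ} {F F' : Forest V} {a b c : V} {l : List V} {B : ℕ}
    {E T : List (V × V)} (hverts : F'.verts.Sublist F.verts) (hsize : F'.size < F.size)
    (hEF : F.edgeSet a b c = F'.edgeSet a b c ∪ edgeFinset E)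
    (hT : edgeFinset T ⊆ triangleEdges a b c) (hEl : ∀ e ∈ E ++ T, e.1 ∈ l ∧ e.2 ∈ l)
    (hfst : ∀ e ∈ E, e.1 ∈ l.drop B) (hmem : ∀ x ∈ l.drop B, x ∈ F.verts)
    (hout : (a :: b :: c :: F.verts).Nodup → ∀ x ∈ l.drop B, x ∉ a :: b :: c :: F'.verts)
    (hflex : (a :: b :: c :: F.verts).Nodup →
      Flexible ((E ++ T).map (Prod.map l.idxOf l.idxOf)) B k) : F.Reducible k a b c := by
  refine ⟨F', hverts, hsize, hEF ▸ Finset.subset_union_left, ?_⟩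
  intro S L hn hS hSF hdeg hL hcol
  have hST : edgeFinset T ⊆ S := hT.trans hS
  have hnot : ∀ x ∈ l.drop B, ∀ e ∈ S ∪ F'.edgeSet a b c, x ∉ e := by
    intro x hx e he
    rcases Finset.mem_union.1 he with he | he
    · exact hSF e he x (hmem x hx)
    · exact notMem_of_mem_edgeSet (hout hn x hx) he
  -- The edges `T` lose their old colours and are coloured again together with `E`.
  have hunion : (S ∪ F'.edgeSet a b c) \ edgeFinset T ∪ edgeFinset (E ++ T) =
      S ∪ F.edgeSet a b c := by
    rw [hEF, edgeFinset_append]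
    ext e
    have := @hST e
    simp only [Finset.mem_union, Finset.mem_sdiff]
    tauto
  rw [← hunion]
  refine ListColorable.extend hEl (hflex hn)
    (fun x hx e he => hnot x hx e (Finset.sdiff_subset he)) ?_ (by rwa [hunion])
    (fun e he => hL e (hunion ▸ Finset.mem_union_right _ he)) (hcol.mono Finset.sdiff_subset)
  rw [Finset.disjoint_left]
  intro e he he'
  rw [edgeFinset_append, Finset.mem_union] at he'
  obtain ⟨he1, he2⟩ := Finset.mem_sdiff.1 he
  obtain ⟨p, hp, rfl⟩ := mem_edgeFinset.1 (he'.resolve_right he2)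
  exact hnot p.1 (hfst p hp) _ he1 (Sym2.mem_mk_left _ _)

theorem map_idxOf_mem_triples {pre : List V} {A B C : Forest V}
    (h : (pre ++ (A.verts ++ (B.verts ++ C.verts))).Nodup) {l : List V}
    (hl : l = pre ++ (A.verts ++ (B.verts ++ C.verts))) :
    (A.map l.idxOf, B.map l.idxOf, C.map l.idxOf) ∈
      triples pre.length (A.size, B.size, C.size) := by
  have hA := map_idxOf_mem_enum h
  have hB := map_idxOf_mem_enum (F := B) (pre := pre ++ A.verts) (post := C.verts)
    (by simpa only [List.append_assoc] using h)
  have hC := map_idxOf_mem_enum (F := C) (pre := pre ++ (A.verts ++ B.verts)) (post := [])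
    (by simpa only [List.append_assoc, List.append_nil] using h)
  simp only [List.append_assoc, List.append_nil, List.length_append, length_verts] at hA hB hC
  subst hl
  simp only [triples, List.mem_flatMap, List.mem_map]
  exact ⟨_, hA, _, hB, _, by rwa [← Nat.add_assoc] at hC, rfl⟩

end Forest

/-! ### The reducible configurations -/

namespace Forest

open EdgeList

variable {V : Type*}

/-- The forest `A` is `A₀` or `A₁`, and the other one is empty. -/
def IsSplit (A A₀ A₁ : Forest V) : Prop := (A₀ = A ∧ A₁ = nil) ∨ (A₀ = nil ∧ A₁ = A)

theorem IsSplit.facts {A A₀ A₁ : Forest V} (h : A.IsSplit A₀ A₁) :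
    A.verts = A₀.verts ++ A₁.verts ∧ A.size = A₀.size + A₁.size ∧
      ∀ a b c, A.edges a b c = A₀.edges a b c ++ A₁.edges a b c := by
  rcases h with ⟨rfl, rfl⟩ | ⟨rfl, rfl⟩ <;> simp [verts, size, edges]

variable [DecidableEq V]

theorem le_idxOf_of_mem_drop {l : List V} (hl : l.Nodup) {n : ℕ} {x : V} (hx : x ∈ l.drop n) :
    n ≤ l.idxOf x := by
  obtain ⟨i, hi, rfl⟩ := List.mem_drop_iff_getElem.1 hx
  rw [hl.idxOf_getElem]
  omega

/-- Without recoloured triangle edges, each edge starts at a deleted vertex, so `Flexible.mono`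
carries the certificate for `m` to all larger `k`. -/
theorem reducible_of_flexible_of_le {k m : ℕ} (hmk : m ≤ k) {F F' : Forest V} {a b c : V}
    {l : List V} {B : ℕ} {E : List (V × V)} (hverts : F'.verts.Sublist F.verts)
    (hsize : F'.size < F.size) (hEF : F.edgeSet a b c = F'.edgeSet a b c ∪ edgeFinset E)
    (hEl : ∀ e ∈ E, e.2 ∈ l) (hfst : ∀ e ∈ E, e.1 ∈ l.drop B)
    (hmem : ∀ x ∈ l.drop B, x ∈ F.verts)
    (hout : (a :: b :: c :: F.verts).Nodup → ∀ x ∈ l.drop B, x ∉ a :: b :: c :: F'.verts)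
    (hl : (a :: b :: c :: F.verts).Nodup → l.Nodup)
    (hflex : (a :: b :: c :: F.verts).Nodup →
      Flexible (E.map (Prod.map l.idxOf l.idxOf)) B m) : F.Reducible k a b c := by
  refine reducible_of_flexible (T := []) hverts hsize hEF (by simp [edgeFinset])
    (fun e he => ?_) hfst hmem hout (fun hn => ?_)
  · rw [List.append_nil] at he
    exact ⟨List.mem_of_mem_drop (hfst e he), hEl e he⟩
  · rw [List.append_nil]
    refine (hflex hn).mono hmk fun e he => ?_
    obtain ⟨e', he', rfl⟩ := List.mem_map.1 he
    exact le_idxOf_of_mem_drop (hl hn) (hfst e' he')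

theorem idxOf_four {a b c p : V} {r : List V} (h : (a :: b :: c :: p :: r).Nodup) :
    (a :: b :: c :: p :: r).idxOf a = 0 ∧ (a :: b :: c :: p :: r).idxOf b = 1 ∧
      (a :: b :: c :: p :: r).idxOf c = 2 ∧ (a :: b :: c :: p :: r).idxOf p = 3 := by
  simp only [List.nodup_cons, List.mem_cons, not_or] at h
  obtain ⟨⟨h1, h2, h3, -⟩, ⟨h4, h5, -⟩, ⟨h6, -⟩, -⟩ := h
  simp [h1, h2, h3, h4, h5, h6]

/-- The vertex `p` is kept, and the forests `A₀`, `B₀`, `C₀` stacked on the triangles at `p` are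
deleted. The boundary is therefore `a`, `b`, `c`, `p`. The splits allow a child forest that is not
needed to stay. -/
theorem reducible_children {k : ℕ} (hk : 6 ≤ k) {a b c p : V}
    {A B C A₀ B₀ C₀ A₁ B₁ C₁ : Forest V} (R : Forest V) (hA : A.IsSplit A₀ A₁)
    (hB : B.IsSplit B₀ B₁) (hC : C.IsSplit C₀ C₁)
    (hn : (A₀.size, B₀.size, C₀.size) ∈ childSizes) :
    (cons p A B C R).Reducible k a b c := by
  obtain ⟨hAv, hAs, hAe⟩ := hA.facts
  obtain ⟨hBv, hBs, hBe⟩ := hB.facts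
  obtain ⟨hCv, hCs, hCe⟩ := hC.facts
  have hpos : 0 < A₀.size + B₀.size + C₀.size := by
    simp only [childSizes, List.mem_cons, Prod.mk.injEq, List.not_mem_nil, or_false] at hn
    omega
  have hl : (a :: b :: c :: (cons p A B C R).verts).Nodup →
      (a :: b :: c :: p :: (A₀.verts ++ (B₀.verts ++ C₀.verts))).Nodup := fun h => by
    rw [verts, hAv, hBv, hCv] at h
    refine h.sublist ?_
    refine (((((List.sublist_append_left _ _).append ((List.sublist_append_left _ _).append
      ((List.sublist_append_left _ _).trans (List.sublist_append_left _ _))))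
        ).cons_cons _).cons_cons _ |>.cons_cons _).cons_cons _
  refine reducible_of_flexible_of_le (m := 6) hk (F' := cons p A₁ B₁ C₁ R)
    (l := a :: b :: c :: p :: (A₀.verts ++ (B₀.verts ++ C₀.verts))) (B := 4)
    (E := A₀.edges p b c ++ (B₀.edges a p c ++ C₀.edges a b p)) ?_ ?_ ?_ ?_ ?_ ?_ ?_ hl
    (fun h => ?_)
  · simp only [verts, hAv, hBv, hCv]
    exact ((List.sublist_append_right _ _).append ((List.sublist_append_right _ _).append
      ((List.sublist_append_right _ _).append_right _))).cons_cons _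
  · simp only [size]
    omega
  · rw [edgeSet_cons, edgeSet_cons]
    simp only [edgeSet, hAe, hBe, hCe, edgeFinset_append]
    ext e
    simp only [Finset.mem_union]
    tauto
  · intro e he
    simp only [List.mem_append] at he
    rcases he with he | he | he <;> have := snd_mem_of_mem_edges he <;>
      simp only [List.mem_cons, List.mem_append] at this ⊢ <;> tauto
  · intro e he
    simp only [List.mem_append] at he
    simp only [List.drop_succ_cons, List.drop_zero, List.mem_append]
    rcases he with he | he | he <;> have := fst_mem_verts_of_mem_edges he <;> tauto
  · intro x hx
    simp only [List.drop_succ_cons, List.drop_zero, List.mem_append] at hx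
    simp only [verts, hAv, hBv, hCv, List.mem_cons, List.mem_append]
    tauto
  · intro h x hx
    simp only [List.drop_succ_cons, List.drop_zero, List.mem_append] at hx
    simp only [verts, hAv, hBv, hCv, List.nodup_cons, List.mem_cons, List.mem_append,
      List.nodup_append] at h ⊢
    grind
  · obtain ⟨h0, h1, h2, h3⟩ := idxOf_four (hl h)
    have h4 := map_idxOf_mem_triples (pre := [a, b, c, p]) (A := A₀) (B := B₀) (C := C₀)
      (hl h) rfl
    have h5 := flexible_childEdges _ (List.mem_map.2 ⟨_, List.mem_flatMap.2 ⟨_, hn, h4⟩, rfl⟩)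
    simp only [childEdges] at h5
    generalize hl' : a :: b :: c :: p :: (A₀.verts ++ (B₀.verts ++ C₀.verts)) = l at *
    have h6 : [a, b, c, p] ++ (A₀.verts ++ (B₀.verts ++ C₀.verts)) = l := hl'
    rw [h6] at h5
    have hAm := edges_map l.idxOf A₀ p b c
    have hBm := edges_map l.idxOf B₀ a p c
    have hCm := edges_map l.idxOf C₀ a b p
    rw [h0, h1, h2, h3] at *
    rwa [List.map_append, List.map_append, ← hAm, ← hBm, ← hCm]

end Forest

namespace Forest

open EdgeList

variable {V : Type*}

theorem exists_isSplit (A : Forest V) (n : ℕ) (hn : n = A.size ∨ n = 0) :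
    ∃ A₀ A₁, A.IsSplit A₀ A₁ ∧ A₀.size = n := by
  rcases hn with rfl | rfl
  · exact ⟨A, nil, Or.inl ⟨rfl, rfl⟩, rfl⟩
  · exact ⟨nil, A, Or.inr ⟨rfl, rfl⟩, rfl⟩

variable [DecidableEq V]

theorem map_idxOf_branch {a b c p : V} {A B C : Forest V} {l : List V}
    (hl : l = a :: b :: c :: p :: (A.verts ++ (B.verts ++ C.verts))) (hn : l.Nodup) :
    ((cons p A B C nil).edges a b c).map (Prod.map l.idxOf l.idxOf) =
        branchEdges (A.map l.idxOf, B.map l.idxOf, C.map l.idxOf) ∧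
      (A.map l.idxOf, B.map l.idxOf, C.map l.idxOf) ∈ triples 4 (A.size, B.size, C.size) ∧
      l.idxOf a = 0 ∧ l.idxOf b = 1 ∧ l.idxOf c = 2 := by
  obtain ⟨h0, h1, h2, h3⟩ := idxOf_four (hl ▸ hn)
  rw [← hl] at h0 h1 h2 h3
  refine ⟨?_, map_idxOf_mem_triples (pre := [a, b, c, p])
    (show (a :: b :: c :: p :: (A.verts ++ (B.verts ++ C.verts))).Nodup from hl ▸ hn) hl, h0, h1, h2⟩
  rw [← edges_map, map, map, h0, h1, h2, h3, branchEdges]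

/-- Here `p` is deleted with everything stacked on the triangles that it spans, and `R` stays; the
boundary is the triangle, some of whose edges may be recoloured. -/
theorem reducible_branch {k : ℕ} {a b c p : V} {A B C R : Forest V} {T : List (V × V)}
    (hT : edgeFinset T ⊆ triangleEdges a b c)
    (hTl : ∀ e ∈ T, e.1 ∈ [a, b, c] ∧ e.2 ∈ [a, b, c])
    (hflex : ∀ l : List V, l = a :: b :: c :: p :: (A.verts ++ (B.verts ++ C.verts)) → l.Nodup →
      Flexible (((cons p A B C nil).edges a b c ++ T).map (Prod.map l.idxOf l.idxOf)) 3 k) :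
    (cons p A B C R).Reducible k a b c := by
  have hverts : (cons p A B C nil).verts = p :: (A.verts ++ (B.verts ++ C.verts)) := by
    simp [verts]
  refine reducible_of_flexible (F' := R) (B := 3) (T := T) (E := (cons p A B C nil).edges a b c)
    (l := a :: b :: c :: p :: (A.verts ++ (B.verts ++ C.verts))) ?_ ?_ ?_ hT ?_ ?_ ?_ ?_
    (fun h => hflex _ rfl ?_)
  · simp only [verts]
    refine List.Sublist.cons _ ?_
    rw [← List.append_assoc, ← List.append_assoc]
    exact List.sublist_append_right _ _
  · simp only [size]
    omega
  · rw [← edgeSet, edgeSet_cons, edgeSet_cons, edgeSet_nil]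
    ext e
    simp only [Finset.mem_union, Finset.notMem_empty]
    tauto
  · intro e he
    rcases List.mem_append.1 he with he | he
    · have h1 := fst_mem_verts_of_mem_edges he
      have h2 := snd_mem_of_mem_edges he
      rw [hverts] at h1 h2
      refine ⟨?_, h2⟩
      simp only [List.mem_cons] at h1 ⊢
      tauto
    · have := hTl e he
      simp only [List.mem_cons, List.not_mem_nil, or_false] at this ⊢
      tauto
  · intro e he
    have h1 := fst_mem_verts_of_mem_edges he
    rwa [hverts] at h1
  · intro x hx
    simp only [List.drop_succ_cons, List.drop_zero, List.mem_append, List.mem_cons] at hx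
    simp only [verts, List.mem_cons, List.mem_append]
    tauto
  · intro h x hx
    simp only [List.drop_succ_cons, List.drop_zero, List.mem_append, List.mem_cons] at hx
    simp only [verts, List.nodup_cons, List.mem_cons, List.mem_append, List.nodup_append] at h ⊢
    grind
  · rw [verts] at h
    refine h.sublist ?_
    exact ((((List.sublist_append_left _ _).append_left _).append_left _).cons_cons
      _).cons_cons _ |>.cons_cons _ |>.cons_cons _

theorem reducible_branch_of_le {k m : ℕ} (hmk : m ≤ k) {a b c p : V} {A B C R : Forest V}
    {N : List (ℕ × ℕ × ℕ)} (hN : ∀ E ∈ (N.flatMap (triples 4)).map branchEdges, Flexible E 3 m)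
    (h : (A.size, B.size, C.size) ∈ N) : (cons p A B C R).Reducible k a b c := by
  refine reducible_branch (T := []) (by simp [edgeFinset]) (by simp) fun l hl hn => ?_
  obtain ⟨h1, h2, -⟩ := map_idxOf_branch hl hn
  rw [List.append_nil]
  refine Flexible.mono (h1 ▸ hN _ (List.mem_map_of_mem (List.mem_flatMap.2 ⟨_, h, h2⟩))) hmk ?_
  intro e he
  obtain ⟨e', he', rfl⟩ := List.mem_map.1 he
  refine le_idxOf_of_mem_drop hn ?_
  have h3 := fst_mem_verts_of_mem_edges he'
  rw [hl]
  simpa [verts] using h3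

theorem reducible_branch_six {a b c p : V} {A B C R : Forest V}
    (h : (A.size, B.size, C.size) ∈ smallBranchSizes) : (cons p A B C R).Reducible 6 a b c := by
  refine reducible_branch (T := [(a, b), (b, c), (a, c)]) ?_ (by simp) fun l hl hn => ?_
  · simp [edgeFinset, triangleEdges]
  obtain ⟨h1, h2, h3, h4, h5⟩ := map_idxOf_branch hl hn
  have h6 := flexible_smallBranchEdges_six _
    (List.mem_map_of_mem (List.mem_flatMap.2 ⟨_, h, h2⟩))
  rw [List.map_append, h1]
  simpa [h3, h4, h5, triangle] using h6

theorem map_idxOf_whole {a b c : V} {F : Forest V} {l : List V} (hl : l = a :: b :: c :: F.verts)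
    (hn : l.Nodup) : F.map l.idxOf ∈ enum F.size 3 ∧
      (F.edges a b c).map (Prod.map l.idxOf l.idxOf) = (F.map l.idxOf).edges 0 1 2 ∧
      l.idxOf a = 0 ∧ l.idxOf b = 1 ∧ l.idxOf c = 2 := by
  have h1 := map_idxOf_mem_enum (F := F) (pre := [a, b, c]) (post := []) (by simpa [hl] using hn)
  rw [List.append_nil] at h1
  have h0 : l.idxOf a = 0 ∧ l.idxOf b = 1 ∧ l.idxOf c = 2 := by
    rw [hl] at hn ⊢
    simp only [List.nodup_cons, List.mem_cons, not_or] at hn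
    obtain ⟨⟨h1, h2, -⟩, ⟨h4, -⟩, -⟩ := hn
    simp [h1, h2, h4]
  refine ⟨?_, ?_, h0⟩
  · rw [hl]
    exact h1
  · rw [← edges_map, h0.1, h0.2.1, h0.2.2]

/-- The whole forest, which has three or four vertices, is deleted. -/
theorem reducible_narrow {k : ℕ} (hk : 6 ≤ k) {a b c p : V} {A B C R : Forest V}
    (h1 : A.size + B.size + C.size ≤ 1) (h2 : R.size ≤ 2)
    (h3 : 3 ≤ (cons p A B C R).size) : (cons p A B C R).Reducible k a b c := by
  set F := cons p A B C R with hF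
  refine reducible_of_flexible_of_le (m := 6) hk (F' := nil) (E := F.edges a b c) (B := 3)
    (l := a :: b :: c :: F.verts) ?_ ?_ ?_ ?_ ?_ ?_ ?_ id (fun hn => ?_)
  · simp [verts]
  · simp only [size]
    omega
  · rw [edgeSet_nil, Finset.empty_union, edgeSet]
  · exact fun e he => snd_mem_of_mem_edges he
  · exact fun e he => fst_mem_verts_of_mem_edges he
  · exact fun x hx => hx
  · intro hn x hx
    simp only [List.drop_succ_cons, List.drop_zero] at hx
    simp only [verts, List.nodup_cons, List.mem_cons, not_or, List.not_mem_nil] at hn ⊢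
    grind
  · generalize hl : a :: b :: c :: F.verts = l at hn
    obtain ⟨h4, h5, -⟩ := map_idxOf_whole hl.symm hn
    rw [h5]
    have h6 : (F.map l.idxOf).IsNarrow := by
      simp [hF, map, IsNarrow, size_map, h1, h2]
    have h7 : F.size = 3 ∨ F.size = 4 := by
      rw [hF, size] at h3 ⊢
      omega
    rcases h7 with h7 | h7 <;> rw [h7] at h4
    · exact flexible_narrow_three _ h4 h6
    · exact flexible_narrow_four _ (List.mem_map_of_mem
        (f := fun F : Forest ℕ => F.edges 0 1 2) (List.mem_filter.2 ⟨h4, h6⟩))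

theorem reducible_children_of_sizes {k : ℕ} (hk : 6 ≤ k) {a b c p : V} {A B C R : Forest V}
    {n : ℕ × ℕ × ℕ} (hn : n ∈ childSizes) (hA : n.1 = A.size ∨ n.1 = 0)
    (hB : n.2.1 = B.size ∨ n.2.1 = 0) (hC : n.2.2 = C.size ∨ n.2.2 = 0) :
    (cons p A B C R).Reducible k a b c := by
  obtain ⟨A₀, A₁, hA, h1⟩ := exists_isSplit A _ hA
  obtain ⟨B₀, B₁, hB, h2⟩ := exists_isSplit B _ hB
  obtain ⟨C₀, C₁, hC, h3⟩ := exists_isSplit C _ hC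
  exact reducible_children hk R hA hB hC (by rwa [h1, h2, h3])

/-- By inheritance it can be assumed that `A`, `B`, `C`, `R` have at most two vertices each. The
number of vertices in `A`, `B`, `C` then decides: up to one, the whole forest goes; for two or
three, `p` and its children; for four or more, children alone. -/
theorem reducible_of_three_le_size {k : ℕ} (hk : 6 ≤ k) {F : Forest V} (hF : 3 ≤ F.size)
    (a b c : V) : F.Reducible k a b c := by
  induction F generalizing a b c with
  | nil => simp [size] at hF
  | cons p A B C R ihA ihB ihC ihR =>
    by_cases hA : 3 ≤ A.size
    · exact (ihA hA _ _ _).cons_first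
    by_cases hB : 3 ≤ B.size
    · exact (ihB hB _ _ _).cons_second
    by_cases hC : 3 ≤ C.size
    · exact (ihC hC _ _ _).cons_third
    by_cases hR : 3 ≤ R.size
    · exact (ihR hR _ _ _).cons_rest
    by_cases h1 : A.size + B.size + C.size ≤ 1
    · exact reducible_narrow hk h1 (by omega) hF
    by_cases h2 : A.size + B.size + C.size = 2
    · have h3 : (A.size, B.size, C.size) ∈ smallBranchSizes := by
        simp only [smallBranchSizes, List.mem_cons, Prod.mk.injEq, List.not_mem_nil, or_false]
        omega
      rcases hk.eq_or_lt with rfl | hk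
      · exact reducible_branch_six h3
      · exact reducible_branch_of_le hk flexible_smallBranchEdges_seven h3
    by_cases h3 : A.size + B.size + C.size = 3
    · refine reducible_branch_of_le hk flexible_branchEdges ?_
      simp only [branchSizes, List.mem_cons, Prod.mk.injEq, List.not_mem_nil, or_false]
      omega
    by_cases h4 : A.size = 2 ∧ B.size = 2
    · exact reducible_children_of_sizes hk (n := (2, 2, 0)) (by simp [childSizes])
        (Or.inl h4.1.symm) (Or.inl h4.2.symm) (Or.inr rfl)
    by_cases h5 : A.size = 2 ∧ C.size = 2
    · exact reducible_children_of_sizes hk (n := (2, 0, 2)) (by simp [childSizes])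
        (Or.inl h5.1.symm) (Or.inr rfl) (Or.inl h5.2.symm)
    by_cases h6 : B.size = 2 ∧ C.size = 2
    · exact reducible_children_of_sizes hk (n := (0, 2, 2)) (by simp [childSizes])
        (Or.inr rfl) (Or.inl h6.1.symm) (Or.inl h6.2.symm)
    -- Three sizes that are at most 2, sum to at least 4 and include 2 at most once.
    have h7 : (A.size = 2 ∧ B.size = 1 ∧ C.size = 1) ∨ (A.size = 1 ∧ B.size = 2 ∧ C.size = 1) ∨
        (A.size = 1 ∧ B.size = 1 ∧ C.size = 2) := by omega
    refine reducible_children_of_sizes hk (n := (A.size, B.size, C.size)) ?_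
      (Or.inl rfl) (Or.inl rfl) (Or.inl rfl)
    rcases h7 with ⟨h8, h9, h10⟩ | ⟨h8, h9, h10⟩ | ⟨h8, h9, h10⟩ <;> rw [h8, h9, h10] <;>
      simp [childSizes]

/-- The edges of the graph obtained by stacking a forest onto a triangle. -/
def graphEdges (F : Forest V) (a b c : V) : Finset (Sym2 V) :=
  triangleEdges a b c ∪ F.edgeSet a b c

theorem graphEdges_eq_edgeFinset (F : Forest V) (a b c : V) :
    F.graphEdges a b c = edgeFinset (F.edges a b c ++ [(a, b), (b, c), (a, c)]) := by
  rw [edgeFinset_append, Finset.union_comm, graphEdges, edgeSet]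
  simp [edgeFinset, triangleEdges]

theorem map_idxOf_graph {a b c : V} {F : Forest V} {l : List V}
    (hl : l = a :: b :: c :: F.verts) (hn : l.Nodup) :
    (F.edges a b c ++ [(a, b), (b, c), (a, c)]).map (Prod.map l.idxOf l.idxOf) =
      (F.map l.idxOf).edges 0 1 2 ++ triangle := by
  obtain ⟨-, h2, h3, h4, h5⟩ := map_idxOf_whole hl hn
  rw [List.map_append, h2]
  simp [h3, h4, h5, triangle]

theorem listColorable_of_flexible {k m : ℕ} (hmk : m ≤ k) {F : Forest V} {a b c : V}
    (hflex : ∀ F' ∈ enum F.size 3, Flexible (F'.edges 0 1 2 ++ triangle) 0 m)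
    (hn : (a :: b :: c :: F.verts).Nodup) (hdeg : ∀ u, edgeDegree (F.graphEdges a b c) u ≤ k)
    {L : Sym2 V → Set ℕ} (hL : ∀ e ∈ F.graphEdges a b c, (k : ℕ∞) ≤ (L e).encard) :
    ListColorable (F.graphEdges a b c) L := by
  have hE : F.graphEdges a b c = ∅ ∪ edgeFinset (F.edges a b c ++ [(a, b), (b, c), (a, c)]) := by
    rw [Finset.empty_union, graphEdges_eq_edgeFinset]
  rw [hE] at hdeg hL ⊢
  refine ListColorable.extend (l := a :: b :: c :: F.verts) (B := 0)
    (fun e he => mem_of_mem_edges_append he) ?_ (by simp) (by simp) hdeg (by simpa using hL)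
    ⟨fun _ => 0, by simp⟩
  rw [map_idxOf_graph rfl hn]
  exact (hflex _ (map_idxOf_whole rfl hn).1).mono hmk (by simp)

/-- Reducible configurations are removed with the base triangle as outer edge set; deletion
preserves the degree bound, and forests with at most two vertices are coloured directly. -/
theorem listColorable_graphEdges {k : ℕ} (hk : 6 ≤ k) {F : Forest V} {a b c : V}
    (hn : (a :: b :: c :: F.verts).Nodup) (hdeg : ∀ u, edgeDegree (F.graphEdges a b c) u ≤ k)
    {L : Sym2 V → Set ℕ} (hL : ∀ e ∈ F.graphEdges a b c, (k : ℕ∞) ≤ (L e).encard) :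
    ListColorable (F.graphEdges a b c) L := by
  induction hs : F.size using Nat.strong_induction_on generalizing F with
  | _ n ih =>
    subst hs
    by_cases hF : 3 ≤ F.size
    · obtain ⟨F', hv, hs, he, h⟩ := reducible_of_three_le_size hk hF a b c
      have hsub : F'.graphEdges a b c ⊆ F.graphEdges a b c := Finset.union_subset_union_right he
      refine h _ L hn subset_rfl ?_ hdeg hL (ih _ hs ?_ ?_ (fun e he => hL e (hsub he)) rfl)
      · intro e he x hx
        simp only [List.nodup_cons, List.mem_cons, not_or] at hn
        simp only [triangleEdges, Finset.mem_insert, Finset.mem_singleton] at he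
        rcases he with rfl | rfl | rfl <;> rw [Sym2.mem_iff] <;> grind
      · exact hn.sublist (((hv.cons_cons _).cons_cons _).cons_cons _)
      · exact fun u => (edgeDegree_mono hsub u).trans (hdeg u)
    · refine listColorable_of_flexible hk (fun F' hF' => ?_) hn hdeg hL
      refine flexible_whole_six _ (List.mem_map_of_mem
        (f := fun F : Forest ℕ => F.edges 0 1 2 ++ triangle) ?_)
      simp only [List.mem_append]
      interval_cases F.size <;> tauto

end Forest

/-! ### Graphs of small maximum degree -/

section ListColoring

variable {V : Type*} [DecidableEq V]

theorem edgeDegree_le_of_listColorable {E : Finset (Sym2 V)} {k : ℕ}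
    (h : ListColorable E fun _ => Set.Iio k) (u : V) : edgeDegree E u ≤ k := by
  obtain ⟨C, hC, hp⟩ := h
  rw [edgeDegree, ← Finset.card_range k]
  refine Finset.card_le_card_of_injOn C (fun e he => ?_) fun e he f hf hef => ?_
  · exact Finset.mem_coe.2 (Finset.mem_range.2 (hC e (Finset.mem_filter.1 he).1))
  · by_contra hne
    have he' := Finset.mem_filter.1 he
    have hf' := Finset.mem_filter.1 hf
    exact hp e he'.1 f hf'.1 hne u he'.2 hf'.2 hef

/-- The colour classes are matchings. -/
theorem card_le_of_listColorable {E : Finset (Sym2 V)} {k m : ℕ} {s : Finset V}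
    (hE : ∀ e ∈ E, ¬e.IsDiag) (hs : ∀ e ∈ E, ∀ x ∈ e, x ∈ s) (hm : s.card ≤ 2 * m + 1)
    (h : ListColorable E fun _ => Set.Iio k) : E.card ≤ m * k := by
  obtain ⟨C, hC, hp⟩ := h
  rw [← Finset.card_range k]
  refine Finset.card_le_mul_card_image_of_maps_to (f := C)
    (fun e he => Finset.mem_range.2 (hC e he)) m fun i _ => ?_
  have h1 : ((E.filter (C · = i)).biUnion Sym2.toFinset).card =
      ∑ e ∈ E.filter (C · = i), e.toFinset.card := by
    refine Finset.card_biUnion fun e he f hf hef => ?_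
    rw [Finset.mem_coe, Finset.mem_filter] at he hf
    rw [Function.onFun, Finset.disjoint_left]
    intro x hxe hxf
    exact hp e he.1 f hf.1 hef x (Sym2.mem_toFinset.1 hxe) (Sym2.mem_toFinset.1 hxf)
      (he.2.trans hf.2.symm)
  rw [Finset.sum_congr rfl fun e he =>
    Sym2.card_toFinset_of_not_isDiag e (hE e (Finset.mem_filter.1 he).1), Finset.sum_const] at h1
  have h2 : ((E.filter (C · = i)).biUnion Sym2.toFinset).card ≤ s.card := by
    refine Finset.card_le_card (Finset.biUnion_subset.2 fun e he x hx => ?_)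
    exact hs e (Finset.mem_filter.1 he).1 x (Sym2.mem_toFinset.1 hx)
  rw [smul_eq_mul] at h1
  omega

end ListColoring

namespace Forest

open EdgeList

variable {V : Type*} [DecidableEq V]

/-- A vertex is kept before anything stacked above it, and the remaining quota is filled greedily
from `A`, `B`, `C`, `R`. Thus a degree bound found by enumeration at one size passes to larger
forests. -/
theorem exists_prune {F : Forest V} {n : ℕ} (hn : n ≤ F.size) : ∃ F' : Forest V,
    F'.size = n ∧ F'.verts.Sublist F.verts ∧ ∀ a b c, F'.edgeSet a b c ⊆ F.edgeSet a b c := by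
  induction F generalizing n with
  | nil =>
    rw [size, Nat.le_zero] at hn
    exact ⟨nil, hn ▸ rfl, List.Sublist.refl _, fun _ _ _ => subset_rfl⟩
  | cons v A B C R ihA ihB ihC ihR =>
    cases n with
    | zero =>
      exact ⟨nil, rfl, List.nil_sublist _, fun a b c => by simp [edgeSet_nil]⟩
    | succ n =>
      rw [size] at hn
      obtain ⟨A', hA, hA', hA''⟩ := ihA (n := min n A.size) (by omega)
      obtain ⟨B', hB, hB', hB''⟩ := ihB (n := min (n - A'.size) B.size) (by omega)
      obtain ⟨C', hC, hC', hC''⟩ := ihC (n := min (n - A'.size - B'.size) C.size) (by omega)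
      obtain ⟨R', hR, hR', hR''⟩ := ihR (n := n - A'.size - B'.size - C'.size) (by omega)
      refine ⟨cons v A' B' C' R', ?_, ?_, fun a b c => ?_⟩
      · rw [size]
        omega
      · exact (hA'.append (hB'.append (hC'.append hR'))).cons_cons _
      · rw [edgeSet_cons, edgeSet_cons]
        exact Finset.union_subset_union (Finset.union_subset_union (Finset.union_subset_union
          (Finset.union_subset_union_right (hA'' _ _ _)) (hB'' _ _ _)) (hC'' _ _ _)) (hR'' _ _ _)

theorem exists_le_edgeDegree {F : Forest V} {a b c : V} {d : ℕ}
    (hn : (a :: b :: c :: F.verts).Nodup)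
    (h : ∀ F' ∈ enum F.size 3, Simple (F'.edges 0 1 2 ++ triangle) ∧
      ∃ u < F.size + 3, d ≤ degree (F'.edges 0 1 2 ++ triangle) u) :
    ∃ u, d ≤ edgeDegree (F.graphEdges a b c) u := by
  obtain ⟨hs, u, hu, hd⟩ := h _ (map_idxOf_whole rfl hn).1
  rw [← map_idxOf_graph rfl hn] at hs hd
  have hu' : u < (a :: b :: c :: F.verts).length := by
    simp only [List.length_cons, length_verts]
    omega
  refine ⟨(a :: b :: c :: F.verts)[u], ?_⟩
  rw [graphEdges_eq_edgeFinset]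
  refine le_trans ?_ (degree_map_idxOf_le (fun e he => mem_of_mem_edges_append he) hs _)
  rwa [hn.idxOf_getElem]

theorem exists_degree_one : ∀ F ∈ enum 1 3, Simple (F.edges 0 1 2 ++ triangle) ∧
    ∃ u < 1 + 3, 3 ≤ degree (F.edges 0 1 2 ++ triangle) u := by
  decide +kernel

theorem exists_degree_three : ∀ F ∈ enum 3 3, Simple (F.edges 0 1 2 ++ triangle) ∧
    ∃ u < 3 + 3, 5 ≤ degree (F.edges 0 1 2 ++ triangle) u := by
  decide +kernel

/-- A 3-tree on seven vertices has a vertex adjacent to all others; the enumeration confirms this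
for every shape. -/
theorem exists_degree_four : ∀ F ∈ enum 4 3, Simple (F.edges 0 1 2 ++ triangle) ∧
    ∃ u < 4 + 3, 6 ≤ degree (F.edges 0 1 2 ++ triangle) u := by
  decide +kernel

theorem exists_six_le_edgeDegree {F : Forest V} {a b c : V}
    (hn : (a :: b :: c :: F.verts).Nodup) (hF : 4 ≤ F.size) :
    ∃ u, 6 ≤ edgeDegree (F.graphEdges a b c) u := by
  obtain ⟨F', hs, hv, he⟩ := exists_prune hF
  obtain ⟨u, hu⟩ := exists_le_edgeDegree (F := F') (a := a) (b := b) (c := c) (d := 6)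
    (hn.sublist (((hv.cons_cons _).cons_cons _).cons_cons _)) (hs ▸ exists_degree_four)
  exact ⟨u, hu.trans (edgeDegree_mono (Finset.union_subset_union_right (he _ _ _)) u)⟩

theorem mem_of_mem_graphEdges {F : Forest V} {a b c : V} {e : Sym2 V}
    (he : e ∈ F.graphEdges a b c) {x : V} (hx : x ∈ e) : x ∈ a :: b :: c :: F.verts := by
  rw [graphEdges_eq_edgeFinset] at he
  obtain ⟨p, hp, rfl⟩ := mem_edgeFinset.1 he
  rcases Sym2.mem_iff.1 hx with rfl | rfl
  · exact (mem_of_mem_edges_append hp).1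
  · exact (mem_of_mem_edges_append hp).2

/-- The graph is K₅ minus an edge, whose maximum degree is only 4. It has nine edges, but a matching
on five vertices has at most two, so 9 ≤ 2k. -/
theorem five_le_of_listColorable {F : Forest V} {a b c : V} {k : ℕ}
    (hn : (a :: b :: c :: F.verts).Nodup) (hF : F.size = 2)
    (hdiag : ∀ e ∈ F.graphEdges a b c, ¬e.IsDiag)
    (h : ListColorable (F.graphEdges a b c) fun _ => Set.Iio k) : 5 ≤ k := by
  have h1 := card_le_of_listColorable (m := 2) (s := (a :: b :: c :: F.verts).toFinset) hdiag
    (fun e he x hx => List.mem_toFinset.2 (mem_of_mem_graphEdges he hx)) (by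
      rw [List.toFinset_card_of_nodup hn]
      simp [length_verts, hF]) h
  have h2 : (F.graphEdges a b c).card = 9 := by
    have h3 := (flexible_whole_five _ (List.mem_map_of_mem
      (f := fun F : Forest ℕ => F.edges 0 1 2 ++ triangle)
      (List.mem_append_left _ (hF ▸ (map_idxOf_whole rfl hn).1)))).1
    rw [← map_idxOf_graph rfl hn] at h3
    rw [graphEdges_eq_edgeFinset, edgeFinset,
      List.toFinset_card_of_nodup (nodup_map_of_simple h3)]
    simp [length_edges, hF]
  omega

/-- The edges of a graph obtained by stacking vertices onto a triangle are list `k`-colourable if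
they are `k`-colourable. -/
theorem listColorable_of_listColorable_const {F : Forest V} {a b c : V} {k : ℕ}
    (hn : (a :: b :: c :: F.verts).Nodup) (hF : 0 < F.size)
    (hdiag : ∀ e ∈ F.graphEdges a b c, ¬e.IsDiag)
    (h : ListColorable (F.graphEdges a b c) fun _ => Set.Iio k) {L : Sym2 V → Set ℕ}
    (hL : ∀ e ∈ F.graphEdges a b c, (k : ℕ∞) ≤ (L e).encard) :
    ListColorable (F.graphEdges a b c) L := by
  have hdeg := edgeDegree_le_of_listColorable h
  by_cases hk : 6 ≤ k
  · exact listColorable_graphEdges hk hn hdeg hL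
  by_cases h4 : 4 ≤ F.size
  · obtain ⟨u, hu⟩ := exists_six_le_edgeDegree hn h4
    have := hdeg u
    omega
  obtain h1 | h2 | h3 : F.size = 1 ∨ F.size = 2 ∨ F.size = 3 := by omega
  · obtain ⟨u, hu⟩ := exists_le_edgeDegree (d := 3) hn (h1 ▸ exists_degree_one)
    exact listColorable_of_flexible (hu.trans (hdeg u)) (fun F' hF' => flexible_whole_three _
      (List.mem_map_of_mem (f := fun F : Forest ℕ => F.edges 0 1 2 ++ triangle) (h1 ▸ hF')))
      hn hdeg hL
  · exact listColorable_of_flexible (five_le_of_listColorable hn h2 hdiag h)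
      (fun F' hF' => flexible_whole_five _ (List.mem_map_of_mem
        (f := fun F : Forest ℕ => F.edges 0 1 2 ++ triangle)
        (List.mem_append_left _ (h2 ▸ hF')))) hn hdeg hL
  · obtain ⟨u, hu⟩ := exists_le_edgeDegree (d := 5) hn (h3 ▸ exists_degree_three)
    exact listColorable_of_flexible (hu.trans (hdeg u)) (fun F' hF' => flexible_whole_five _
      (List.mem_map_of_mem (f := fun F : Forest ℕ => F.edges 0 1 2 ++ triangle)
        (List.mem_append_right _ (by rwa [h3] at hF')))) hn hdeg hL

end Forest

/-! ### Stacking further vertices -/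

namespace Forest

variable {V : Type*}

/-- A clique vertex strictly inside a subforest forces the other two into that subforest or its
triangle. If there is none, all three are among `a`, `b`, `c`, `v`, and any three of these span one
of the four triangles. -/
theorem forall_mem_or_of_pairwise {a b c v x y z : V} {A B C R : List V} (hxy : x ≠ y)
    (hxz : x ≠ z) (hyz : y ≠ z)
    (hmem : ∀ u ∈ [x, y, z], u ∈ a :: b :: c :: v :: (A ++ (B ++ (C ++ R))))
    (h : ∀ u ∈ [x, y, z], ∀ w ∈ [x, y, z], u ≠ w → (u ∈ A → w ∈ v :: b :: c :: A) ∧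
      (u ∈ B → w ∈ a :: v :: c :: B) ∧ (u ∈ C → w ∈ a :: b :: v :: C) ∧
      (u ∈ R → w ∈ a :: b :: c :: R)) :
    (∀ w ∈ [x, y, z], w ∈ v :: b :: c :: A) ∨ (∀ w ∈ [x, y, z], w ∈ a :: v :: c :: B) ∨
      (∀ w ∈ [x, y, z], w ∈ a :: b :: v :: C) ∨ ∀ w ∈ [x, y, z], w ∈ a :: b :: c :: R := by
  by_cases hA : ∃ u ∈ [x, y, z], u ∈ A
  · obtain ⟨u, hu, huA⟩ := hA
    refine Or.inl fun w hw => ?_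
    by_cases huw : u = w
    · simp [← huw, huA]
    · exact (h u hu w hw huw).1 huA
  by_cases hB : ∃ u ∈ [x, y, z], u ∈ B
  · obtain ⟨u, hu, huB⟩ := hB
    refine Or.inr (Or.inl fun w hw => ?_)
    by_cases huw : u = w
    · simp [← huw, huB]
    · exact (h u hu w hw huw).2.1 huB
  by_cases hC : ∃ u ∈ [x, y, z], u ∈ C
  · obtain ⟨u, hu, huC⟩ := hC
    refine Or.inr (Or.inr (Or.inl fun w hw => ?_))
    by_cases huw : u = w
    · simp [← huw, huC]
    · exact (h u hu w hw huw).2.2.1 huC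
  by_cases hR : ∃ u ∈ [x, y, z], u ∈ R
  · obtain ⟨u, hu, huR⟩ := hR
    refine Or.inr (Or.inr (Or.inr fun w hw => ?_))
    by_cases huw : u = w
    · simp [← huw, huR]
    · exact (h u hu w hw huw).2.2.2 huR
  have hcorner : ∀ u ∈ [x, y, z], u = a ∨ u = b ∨ u = c ∨ u = v := fun u hu => by
    have h1 : u ∉ A := fun h => hA ⟨u, hu, h⟩
    have h2 : u ∉ B := fun h => hB ⟨u, hu, h⟩
    have h3 : u ∉ C := fun h => hC ⟨u, hu, h⟩
    have h4 : u ∉ R := fun h => hR ⟨u, hu, h⟩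
    simpa [h1, h2, h3, h4] using hmem u hu
  clear h hmem hA hB hC hR
  simp only [List.mem_cons, List.not_mem_nil, or_false, forall_eq_or_imp, forall_eq] at hcorner ⊢
  obtain ⟨hx, hy, hz⟩ := hcorner
  rcases hx with rfl | rfl | rfl | rfl <;> rcases hy with rfl | rfl | rfl | rfl <;>
    rcases hz with rfl | rfl | rfl | rfl <;> first | contradiction | simp

variable [DecidableEq V]

/-- If the edges at vertices of `X` stacked onto `p, q, r` are edges of `X`, then so are those
among these vertices. -/
theorem mem_graphEdges_of_mem {X : Forest V} {p q r y z : V} {S : Finset (Sym2 V)}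
    (hX : ∀ e ∈ S, ∀ x ∈ X.verts, x ∈ e → e ∈ X.edgeSet p q r)
    (hy : y ∈ p :: q :: r :: X.verts) (hz : z ∈ p :: q :: r :: X.verts) (hyz : y ≠ z)
    (he : s(y, z) ∈ S) : s(y, z) ∈ X.graphEdges p q r := by
  by_cases h1 : y ∈ X.verts
  · exact Finset.mem_union_right _ (hX _ he y h1 (Sym2.mem_mk_left _ _))
  by_cases h2 : z ∈ X.verts
  · exact Finset.mem_union_right _ (hX _ he z h2 (Sym2.mem_mk_right _ _))
  refine Finset.mem_union_left _ ?_
  simp only [List.mem_cons, h1, h2, or_false] at hy hz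
  rcases hy with rfl | rfl | rfl <;> rcases hz with rfl | rfl | rfl <;>
    simp_all [triangleEdges]

/-- The vertex sets of the subforests are disjoint from each other and from the corners, so an edge
with an end inside a subforest can only belong to that subforest. -/
theorem mem_edgeSet_of_cons {v a b c x : V} {A B C R : Forest V} {e : Sym2 V}
    (hn : (a :: b :: c :: (cons v A B C R).verts).Nodup)
    (he : e ∈ (cons v A B C R).graphEdges a b c) (hx : x ∈ e) :
    (x ∈ A.verts → e ∈ A.edgeSet v b c) ∧ (x ∈ B.verts → e ∈ B.edgeSet a v c) ∧
      (x ∈ C.verts → e ∈ C.edgeSet a b v) ∧ (x ∈ R.verts → e ∈ R.edgeSet a b c) := by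
  simp only [verts, List.nodup_cons, List.mem_cons, List.mem_append, List.nodup_append] at hn
  rw [graphEdges, edgeSet_cons] at he
  simp only [Finset.mem_union] at he
  rcases he with he | ((((he | he) | he) | he) | he)
  · have : x = a ∨ x = b ∨ x = c := by
      simp only [triangleEdges, Finset.mem_insert, Finset.mem_singleton] at he
      rcases he with rfl | rfl | rfl <;> rw [Sym2.mem_iff] at hx <;> tauto
    grind
  · have : x = v ∨ x = a ∨ x = b ∨ x = c := by
      simp only [spokes, Finset.mem_insert, Finset.mem_singleton] at he
      rcases he with rfl | rfl | rfl <;> rw [Sym2.mem_iff] at hx <;> tauto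
    grind
  all_goals
    have := mem_of_mem_edgeSet he hx
    simp only [List.mem_cons] at this
    grind

/-- The triangle `x, y, z` is followed down into the subforest that contains it until it is the base
triangle of an empty forest, up to order; there `w` is stacked. -/
theorem exists_insert {F : Forest V} {a b c x y z : V} (w : V)
    (hn : (a :: b :: c :: F.verts).Nodup) (hxy : x ≠ y) (hxz : x ≠ z) (hyz : y ≠ z)
    (h1 : s(x, y) ∈ F.graphEdges a b c) (h2 : s(x, z) ∈ F.graphEdges a b c)
    (h3 : s(y, z) ∈ F.graphEdges a b c) : ∃ F' : Forest V, F'.verts.Perm (w :: F.verts) ∧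
      F'.edgeSet a b c = spokes w x y z ∪ F.edgeSet a b c := by
  induction F generalizing a b c with
  | nil =>
    refine ⟨cons w nil nil nil nil, by simp [verts], ?_⟩
    have hx := mem_of_mem_graphEdges h1 (Sym2.mem_mk_left _ _)
    have hy := mem_of_mem_graphEdges h1 (Sym2.mem_mk_right _ _)
    have hz := mem_of_mem_graphEdges h2 (Sym2.mem_mk_right _ _)
    simp only [edgeSet_cons, edgeSet_nil, Finset.union_empty]
    simp only [verts, List.mem_cons, List.not_mem_nil, or_false] at hx hy hz
    ext e
    simp only [spokes, Finset.mem_insert, Finset.mem_singleton]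
    rcases hx with rfl | rfl | rfl <;> rcases hy with rfl | rfl | rfl <;>
      rcases hz with rfl | rfl | rfl <;> first | contradiction | tauto
  | cons v A B C R ihA ihB ihC ihR =>
    have hX := fun {e} he x hx => mem_edgeSet_of_cons (x := x) (e := e) hn he hx
    have hA := fun {y z} => mem_graphEdges_of_mem (y := y) (z := z)
      (fun e he x hx hxe => (hX he x hxe).1 hx)
    have hB := fun {y z} => mem_graphEdges_of_mem (y := y) (z := z)
      (fun e he x hx hxe => (hX he x hxe).2.1 hx)
    have hC := fun {y z} => mem_graphEdges_of_mem (y := y) (z := z)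
      (fun e he x hx hxe => (hX he x hxe).2.2.1 hx)
    have hR := fun {y z} => mem_graphEdges_of_mem (y := y) (z := z)
      (fun e he x hx hxe => (hX he x hxe).2.2.2 hx)
    have hadj : ∀ u ∈ [x, y, z], ∀ w ∈ [x, y, z], u ≠ w →
        s(u, w) ∈ (cons v A B C R).graphEdges a b c := by
      simp only [List.mem_cons, List.not_mem_nil, or_false]
      rintro u (rfl | rfl | rfl) w (rfl | rfl | rfl) huw <;>
        first | contradiction | assumption | rwa [Sym2.eq_swap]
    have key := forall_mem_or_of_pairwise (a := a) (b := b) (c := c) (v := v) (A := A.verts)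
      (B := B.verts) (C := C.verts) (R := R.verts) hxy hxz hyz (fun u hu => ?_)
      fun u hu w hw huw => ?_
    rotate_left
    · have hu' : ∃ w, s(u, w) ∈ (cons v A B C R).graphEdges a b c := by
        simp only [List.mem_cons, List.not_mem_nil, or_false] at hu
        rcases hu with rfl | rfl | rfl
        · exact ⟨_, h1⟩
        · exact ⟨_, h3⟩
        · exact ⟨y, by rwa [Sym2.eq_swap]⟩
      obtain ⟨w, hw⟩ := hu'
      exact mem_of_mem_graphEdges hw (Sym2.mem_mk_left _ _)
    · obtain ⟨h1, h2, h3, h4⟩ := hX (hadj u hu w hw huw) u (Sym2.mem_mk_left _ _)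
      have hz := Sym2.mem_mk_right u w
      exact ⟨fun h => mem_of_mem_edgeSet (h1 h) hz, fun h => mem_of_mem_edgeSet (h2 h) hz,
        fun h => mem_of_mem_edgeSet (h3 h) hz, fun h => mem_of_mem_edgeSet (h4 h) hz⟩
    simp only [List.forall_mem_cons, List.not_mem_nil, false_imp_iff, implies_true, and_true]
      at key
    rcases key with ⟨hx, hy, hz⟩ | ⟨hx, hy, hz⟩ | ⟨hx, hy, hz⟩ | ⟨hx, hy, hz⟩
    · obtain ⟨X, hp, he⟩ := ihA (a := v) (b := b) (c := c) (by
        simp only [verts, List.nodup_cons, List.mem_cons, List.mem_append,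
          List.nodup_append] at hn ⊢
        grind) (hA hx hy hxy h1) (hA hx hz hxz h2) (hA hy hz hyz h3)
      refine ⟨cons v X B C R, ?_, ?_⟩
      · exact (List.Perm.cons v (hp.append_right _)).trans (List.Perm.swap _ _ _)
      · rw [edgeSet_cons, edgeSet_cons, he]
        ac_rfl
    · obtain ⟨X, hp, he⟩ := ihB (a := a) (b := v) (c := c) (by
        simp only [verts, List.nodup_cons, List.mem_cons, List.mem_append,
          List.nodup_append] at hn ⊢
        grind) (hB hx hy hxy h1) (hB hx hz hxz h2) (hB hy hz hyz h3)
      refine ⟨cons v A X C R, ?_, ?_⟩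
      · exact (List.Perm.cons v (((hp.append_right _).append_left _).trans
          List.perm_middle)).trans (List.Perm.swap _ _ _)
      · rw [edgeSet_cons, edgeSet_cons, he]
        ac_rfl
    · obtain ⟨X, hp, he⟩ := ihC (a := a) (b := b) (c := v) (by
        simp only [verts, List.nodup_cons, List.mem_cons, List.mem_append,
          List.nodup_append] at hn ⊢
        grind) (hC hx hy hxy h1) (hC hx hz hxz h2) (hC hy hz hyz h3)
      refine ⟨cons v A B X R, ?_, ?_⟩
      · exact (List.Perm.cons v (((((hp.append_right _).append_left _).trans
          List.perm_middle).append_left _).trans List.perm_middle)).trans (List.Perm.swap _ _ _)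
      · rw [edgeSet_cons, edgeSet_cons, he]
        ac_rfl
    · obtain ⟨X, hp, he⟩ := ihR (a := a) (b := b) (c := c) (by
        simp only [verts, List.nodup_cons, List.mem_cons, List.mem_append,
          List.nodup_append] at hn ⊢
        grind) (hR hx hy hxy h1) (hR hx hz hxz h2) (hR hy hz hyz h3)
      refine ⟨cons v A B C X, ?_, ?_⟩
      · exact (List.Perm.cons v ((((((hp.append_left _).trans List.perm_middle).append_left _).trans
          List.perm_middle).append_left _).trans List.perm_middle)).trans (List.Perm.swap _ _ _)
      · rw [edgeSet_cons, edgeSet_cons, he]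
        ac_rfl

end Forest

/-! ### 3-trees -/

namespace SimpleGraph

variable {V : Type*} {G : SimpleGraph V}

theorem mem_spokes_iff [DecidableEq V] {v x y z u w : V} : s(u, w) ∈ Forest.spokes v x y z ↔
    (u = v ∧ w ∈ ({x, y, z} : Finset V)) ∨ (w = v ∧ u ∈ ({x, y, z} : Finset V)) := by
  simp only [Forest.spokes, Finset.mem_insert, Finset.mem_singleton, Sym2.eq_iff]
  tauto

/-- A 3-tree arises by stacking a forest onto a triangle. -/
theorem IsKTreeOn.exists_forest [DecidableEq V] {s : Finset V} (h : G.IsKTreeOn 3 s) :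
    ∃ (a b c : V) (F : Forest V), (a :: b :: c :: F.verts).Nodup ∧ 0 < F.size ∧
      (∀ x, x ∈ a :: b :: c :: F.verts ↔ x ∈ s) ∧
      ∀ u w, s(u, w) ∈ F.graphEdges a b c ↔ G.Adj u w ∧ u ∈ s ∧ w ∈ s := by
  induction h with
  | complete s hs =>
    -- In the initial K₄ any vertex `d` can be regarded as stacked onto the other three; this makes
    -- the forest nonempty.
    obtain ⟨d, hd⟩ : s.Nonempty := Finset.card_pos.1 (by rw [hs.card_eq]; omega)
    obtain ⟨a, b, c, hab, hac, hbc, hK⟩ := is3Clique_iff.1 (hs.erase_of_mem hd)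
    have hs' : s = insert d {a, b, c} := by rw [← hK, Finset.insert_erase hd]
    have hmem : ∀ x ∈ ({a, b, c} : Finset V), d ≠ x ∧ G.Adj d x := fun x hx => by
      rw [← hK, Finset.mem_erase] at hx
      exact ⟨hx.1.symm, hs.isClique hd hx.2 hx.1.symm⟩
    simp only [Finset.mem_insert, Finset.mem_singleton, forall_eq_or_imp, forall_eq] at hmem
    obtain ⟨⟨-, hda⟩, ⟨-, hdb⟩, ⟨-, hdc⟩⟩ := hmem
    refine ⟨a, b, c, .cons d .nil .nil .nil .nil, ?_, by simp [Forest.size], fun x => ?_,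
      fun u w => ?_⟩
    · simp [Forest.verts, hab.ne, hac.ne, hbc.ne, hda.ne', hdb.ne', hdc.ne']
    · simp only [hs', Forest.verts, List.append_nil, List.mem_cons, List.not_mem_nil, or_false,
        Finset.mem_insert, Finset.mem_singleton]
      tauto
    · simp only [Forest.graphEdges, Forest.edgeSet_cons, Forest.edgeSet_nil, Finset.union_empty,
        Forest.triangleEdges, Forest.spokes, Finset.mem_union, Finset.mem_insert,
        Finset.mem_singleton, Sym2.eq_iff, hs']
      constructor
      · rintro ((h | h | h) | (h | h | h)) <;> obtain ⟨rfl, rfl⟩ | ⟨rfl, rfl⟩ := h <;>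
          simp [hab, hac, hbc, hda, hdb, hdc, hab.symm, hac.symm, hbc.symm, hda.symm, hdb.symm,
            hdc.symm]
      · rintro ⟨h, hu, hw⟩
        have := h.ne
        rcases hu with rfl | rfl | rfl | rfl <;> rcases hw with rfl | rfl | rfl | rfl <;>
          simp at this ⊢
  | add s v hv K hKs hK hadj hs ih =>
    obtain ⟨a, b, c, F, hn, -, hx, he⟩ := ih
    obtain ⟨x, y, z, hxy, hxz, hyz, rfl⟩ := is3Clique_iff.1 hK
    have hxs : x ∈ s := hKs (by simp)
    have hys : y ∈ s := hKs (by simp)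
    have hzs : z ∈ s := hKs (by simp)
    obtain ⟨F', hp, hF'⟩ := Forest.exists_insert v hn hxy.ne hxz.ne hyz.ne
      ((he x y).2 ⟨hxy, hxs, hys⟩) ((he x z).2 ⟨hxz, hxs, hzs⟩) ((he y z).2 ⟨hyz, hys, hzs⟩)
    refine ⟨a, b, c, F', ?_, ?_, fun u => ?_, fun u w => ?_⟩
    · have h1 : (v :: (a :: b :: c :: F.verts)).Nodup :=
        List.nodup_cons.2 ⟨fun h => hv ((hx v).1 h), hn⟩
      refine List.Perm.nodup ?_ h1
      rw [List.perm_iff_count] at hp ⊢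
      intro t
      have := hp t
      simp only [List.count_cons] at this ⊢
      omega
    · rw [← Forest.length_verts, hp.length_eq, List.length_cons]
      omega
    · rw [Finset.mem_cons, ← hx]
      simp only [List.mem_cons, hp.mem_iff]
      tauto
    · have h1 : s(u, w) ∈ F'.graphEdges a b c ↔
          s(u, w) ∈ Forest.spokes v x y z ∨ s(u, w) ∈ F.graphEdges a b c := by
        simp only [Forest.graphEdges, hF', Finset.mem_union]
        tauto
      rw [h1, he, mem_spokes_iff, Finset.mem_cons, Finset.mem_cons]
      constructor
      · rintro ((⟨rfl, h⟩ | ⟨rfl, h⟩) | ⟨h, hu, hw⟩)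
        · exact ⟨(hadj w (hKs h)).2 h, Or.inl rfl, Or.inr (hKs h)⟩
        · exact ⟨((hadj u (hKs h)).2 h).symm, Or.inr (hKs h), Or.inl rfl⟩
        · exact ⟨h, Or.inr hu, Or.inr hw⟩
      · rintro ⟨h, rfl | hu, rfl | hw⟩
        · exact absurd rfl h.ne
        · exact Or.inl (Or.inl ⟨rfl, (hadj w hw).1 h⟩)
        · exact Or.inl (Or.inr ⟨rfl, (hadj u hu).1 h.symm⟩)
        · exact Or.inr ⟨h, hu, hw⟩

theorem edgeChoosable_of_listColorable {k : ℕ} {E : Finset (Sym2 V)}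
    (hE : ∀ e, e ∈ E ↔ e ∈ G.edgeSet)
    (h : ∀ L : Sym2 V → Set ℕ, (∀ e ∈ E, (k : ℕ∞) ≤ (L e).encard) → ListColorable E L) :
    G.EdgeChoosable k := by
  classical
  intro L hL
  obtain ⟨C, hC, hp⟩ := h (fun e => if he : e ∈ G.edgeSet then L ⟨e, he⟩ else ∅) fun e he => by
    rw [dif_pos ((hE e).1 he)]
    exact hL _
  refine ⟨fun e => C e, fun e => ?_, fun e f hef => ?_⟩
  · simpa using hC e ((hE _).2 e.2)
  · obtain ⟨hne, v, hve, hvf⟩ := lineGraph_adj_iff_exists.1 hef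
    exact hp e ((hE _).2 e.2) f ((hE _).2 f.2) (fun h => hne (Subtype.ext h)) v hve hvf

theorem listColorable_of_colorable_lineGraph {k : ℕ} {E : Finset (Sym2 V)}
    (hE : ∀ e, e ∈ E ↔ e ∈ G.edgeSet) (h : G.lineGraph.Colorable k) :
    ListColorable E fun _ => Set.Iio k := by
  classical
  obtain ⟨C⟩ := h
  refine ⟨fun e => if he : e ∈ G.edgeSet then C ⟨e, he⟩ else 0, fun e he => ?_,
    fun e he f hf hef v hve hvf => ?_⟩
  · simp only [dif_pos ((hE e).1 he)]
    exact (C _).2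
  · simp only [dif_pos ((hE e).1 he), dif_pos ((hE f).1 hf)]
    refine fun h => C.valid (lineGraph_adj_iff_exists.2 ⟨?_, v, hve, hvf⟩) (Fin.ext h)
    exact fun h => hef (congrArg Subtype.val h)

/-- Ordinary colouring is the case of equal lists `{0, …, k - 1}`. -/
theorem EdgeChoosable.colorable_lineGraph {k : ℕ} (h : G.EdgeChoosable k) :
    G.lineGraph.Colorable k := by
  obtain ⟨C, hC, hp⟩ := h (fun _ => Set.Iio k) fun _ => by
    rw [← Finset.coe_Iio, Set.encard_coe_eq_coe_finsetCard, Nat.card_Iio]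
  exact ⟨Coloring.mk (fun e => (⟨C e, hC e⟩ : Fin k)) fun {e f} hef h =>
    hp e f hef (congrArg Fin.val h)⟩

theorem chromaticIndex_le_listChromaticIndex : G.chromaticIndex ≤ G.listChromaticIndex :=
  le_iInf₂ fun _ hk => hk.colorable_lineGraph.chromaticNumber_le

end SimpleGraph

theorem theorem2 {V : Type*} [Fintype V] (G : SimpleGraph V) (hG : G.IsKTree 3) :
    G.listChromaticIndex = G.chromaticIndex := by
  classical
  refine le_antisymm ?_ G.chromaticIndex_le_listChromaticIndex
  obtain ⟨a, b, c, F, hn, hF, -, he⟩ := SimpleGraph.IsKTreeOn.exists_forest hG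
  have hE : ∀ e, e ∈ F.graphEdges a b c ↔ e ∈ G.edgeSet := by
    refine Sym2.ind fun u w => ?_
    simp [he]
  have hcol := G.lineGraph.colorable_chromaticNumber_of_fintype
  -- The chromatic index of a finite graph is finite, so it can be used as a list size.
  obtain ⟨k, hk⟩ : ∃ k : ℕ, G.chromaticIndex = k :=
    ⟨_, (ENat.natCast_toNat (SimpleGraph.chromaticNumber_ne_top_iff_exists.2 ⟨_, hcol⟩)).symm⟩
  have hcol : G.lineGraph.Colorable k := SimpleGraph.chromaticNumber_le_iff_colorable.1 hk.le
  rw [hk]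
  refine iInf₂_le k (SimpleGraph.edgeChoosable_of_listColorable hE fun L hL => ?_)
  exact Forest.listColorable_of_listColorable_const hn hF
    (fun e h => G.not_isDiag_of_mem_edgeSet ((hE e).1 h))
    (SimpleGraph.listColorable_of_colorable_lineGraph hE hcol) hL
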